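/- Let $\beta>1$ and $l\in\big[-\frac{\beta}{\beta+1},-\frac{1}{\beta+1}\big]$. Let $T(x)=-\beta x-\lfloor-\beta x-l\rfloor$ on $[l,l+1)$. The expansion of $x\in[l,l+1)$ is the digit string $d(x)=x_1x_2x_3\cdots$ with $x_i=\lfloor-\beta T^{i-1}(x)-l\rfloor$. An infinite string of integers is admissible if it equals $d(x)$ for some $x\in[l,l+1)$, and $x_1x_2\cdots$ is strongly admissible if $0x_1x_2\cdots$ is admissible. For a finite string put $\gamma(a_{k-1}\cdots a_0)=\sum_{i=0}^{k-1}a_i(-\beta)^i$, and let $$\mathbb{Z}_{-\beta}=\{\gamma(a_{k-1}\cdots a_0)\;:\;k\ge 0,\ a_{k-1}\cdots a_00^\omega\text{ is admissible}\}.$$ The alternate order on infinite integer strings is defined by $u\prec_{alt}v$ iff $(-1)^mu_m<(-1)^mv_m$, where $m\ge1$ is the first index with $u_m\ne v_m$. For $k\ge 0$, let $\mathrm{Min}(k)$ and $\mathrm{Max}(k)$ be the least and the greatest element, in the alternate order, of the (finite, non-empty) set of admissible strings of the form $a_{k-1}\cdots a_00^\omega$, and let $\min(k)$, $\max(k)$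 be their prefixes of length $k$. Assume $\mathbb{Z}_{-\beta}\neq\{0\}$. Then there is a unique strictly increasing sequence $(z_n)_{n\in\mathbb{Z}}$ with $z_0=0$ and $\mathbb{Z}_{-\beta}=\{z_n: n\in\mathbb{Z}\}$. Moreover, there is a unique bi-infinite word $\mathbf{v}_{-\beta}=(v_n)_{n\in\mathbb{Z}}$ over $\mathbb{N}=\{0,1,2,\dots\}$ such that for every $n$, with $k=v_n$, there are a finite integer word $w$ and a $d\in\mathbb{Z}$ for which $w(d-1)\mathrm{Max}(k)$ and $wd\,\mathrm{Min}(k)$ are strongly admissible and $$z_n=\gamma(w(d-1)\max(k)),\quad z_{n+1}=\gamma(wd\min(k))\qquad\text{if }k\text{ is even},$$ $$z_n=\gamma(wd\min(k)),\quad z_{n+1}=\gamma(w(d-1)\max(k))\qquad\text{if }k\text{ is odd}.$$ In particular $z_{n+1}-z_n=\Delta_{v_n}$, where $\Delta_k=\big|(-\beta)^k+\gamma(\min(k))-\gamma(\max(k))\big|$. There exists an antimorphism $\Phi:\mathbb{N}^*\to\mathbb{N}^*$ (that is, $\Phi(uw)=\Phi(w)\Phi(u)$ for all words $u,w$) such that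 $\Psi=\Phi^2$ is a non-erasing morphism different from the identity and $\Psi(\mathbf{v}_{-\beta})=\mathbf{v}_{-\beta}$, where $\Psi(\mathbf{v})=\cdots\Psi(v_{-2})\Psi(v_{-1})|\Psi(v_0)\Psi(v_1)\cdots$ and $|$ marks the place between the letters of index $-1$ and $0$. The antimorphism $\Phi$ can be chosen so that for all $m\ge 0$ $$\Phi(2m)=S_{2m}\,(2m+1)\,\widetilde{R_{2m}}\qquad\text{and}\qquad\Phi(2m+1)=R_{2m+1}\,(2m+2)\,\widetilde{S_{2m+1}},$$ where $\widetilde{u}$ is the reversal of $u$ and the words $R_j,S_j\in\mathbb{N}^*$ depend only on $j$ and on $\min(j),\max(j),\min(j+1),\max(j+1)$; that is, $R_j$ and $S_j$ are the values at $(j,\min(j),\max(j),\min(j+1),\max(j+1))$ of functions that are the same for all $\beta$ and $l$. -/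

import Mathlib

namespace NegBeta

/-! Digit strings `x₁x₂x₃⋯` are functions `ℕ → ℤ` with `x i` standing for `x_{i+1}`; finite digit
strings are lists of integers, read from left to right (most significant digit first). -/

/-- The `(-β)`-transformation `T(x) = -βx - ⌊-βx - l⌋`; it maps `[l, l+1)` into itself. -/
noncomputable def T (β l x : ℝ) : ℝ := -β * x - (⌊-β * x - l⌋ : ℝ)

/-- The `(-β)`-expansion `d(x) = x₁x₂x₃⋯`, `x_i = ⌊-β T^{i-1}(x) - l⌋`, of `x ∈ [l, l+1)`. -/
noncomputable def expansion (β l x : ℝ) : ℕ → ℤ := fun i => ⌊-β * (T β l)^[i] x - l⌋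

/-- An infinite string is admissible if it is the expansion of some `x ∈ [l, l+1)`. -/
def Admissible (β l : ℝ) (s : ℕ → ℤ) : Prop :=
  ∃ x ∈ Set.Ico l (l + 1), s = expansion β l x

/-- The string `0x₁x₂x₃⋯`. -/
def zeroCons (s : ℕ → ℤ) : ℕ → ℤ
  | 0 => 0
  | i + 1 => s i

/-- A string is strongly admissible if it is admissible after prefixing the digit `0`. -/
def StronglyAdmissible (β l : ℝ) (s : ℕ → ℤ) : Prop := Admissible β l (zeroCons s)

/-- The infinite string `u0^ω`. -/
def padZero (u : List ℤ) : ℕ → ℤ := fun i => u.getD i 0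

/-- The value function `γ(a_{k-1}⋯a₁a₀) = ∑ a_i (-β)^i`. -/
noncomputable def gamma (β : ℝ) : List ℤ → ℝ
  | [] => 0
  | a :: u => (a : ℝ) * (-β) ^ u.length + gamma β u

/-- The set `ℤ_{-β}` of `(-β)`-integers. -/
def integers (β l : ℝ) : Set ℝ :=
  {x | ∃ u : List ℤ, Admissible β l (padZero u) ∧ x = gamma β u}

/-- The strict alternate order: `u_m(-1)^m < v_m(-1)^m` at the first place `m` (counted from `1`)
where the strings differ. -/
def AltLT (u v : ℕ → ℤ) : Prop :=
  ∃ m, (∀ i < m, u i = v i) ∧ u m * (-1) ^ (m + 1) < v m * (-1) ^ (m + 1)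

/-- The alternate order. -/
def AltLE (u v : ℕ → ℤ) : Prop := u = v ∨ AltLT u v

/-- `𝒮(k)`: the admissible strings that become `0^ω` after erasing the prefix of length `k`. -/
def stringSet (β l : ℝ) (k : ℕ) : Set (ℕ → ℤ) :=
  {s | Admissible β l s ∧ ∀ i, k ≤ i → s i = 0}

/-- `Max(k)`: the greatest element of `𝒮(k)` in the alternate order. (It exists whenever `1 < β`
and `-1 < l ≤ 0`, since `𝒮(k)` is then finite and contains `0^ω`.) -/
noncomputable def maxString (β l : ℝ) (k : ℕ) : ℕ → ℤ :=
  Classical.epsilon fun s => s ∈ stringSet β l k ∧ ∀ t ∈ stringSet β l k, AltLE t s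

/-- `Min(k)`: the least element of `𝒮(k)` in the alternate order. -/
noncomputable def minString (β l : ℝ) (k : ℕ) : ℕ → ℤ :=
  Classical.epsilon fun s => s ∈ stringSet β l k ∧ ∀ t ∈ stringSet β l k, AltLE s t

/-- `max(k)`: the prefix of length `k` of `Max(k)`. -/
noncomputable def maxPrefix (β l : ℝ) (k : ℕ) : List ℤ := (List.range k).map (maxString β l k)

/-- `min(k)`: the prefix of length `k` of `Min(k)`. -/
noncomputable def minPrefix (β l : ℝ) (k : ℕ) : List ℤ := (List.range k).map (minString β l k)

/-- `Δ_k = |(-β)^k + γ(min(k)) - γ(max(k))|`. -/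
noncomputable def gapLength (β l : ℝ) (k : ℕ) : ℝ :=
  |(-β) ^ k + gamma β (minPrefix β l k) - gamma β (maxPrefix β l k)|

/-- The gap from `x` to `y` is of type `k`: for some word `w` and digit `d` such that
`w(d-1)Max(k)` and `wdMin(k)` are strongly admissible, `x` and `y` are the numbers
`γ(w(d-1)max(k))` and `γ(wd min(k))`, in this order for `k` even and in the other for `k` odd. -/
def IsGapOfType (β l : ℝ) (k : ℕ) (x y : ℝ) : Prop :=
  ∃ (w : List ℤ) (d : ℤ),
    StronglyAdmissible β l (padZero (w ++ (d - 1) :: maxPrefix β l k)) ∧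
    StronglyAdmissible β l (padZero (w ++ d :: minPrefix β l k)) ∧
    (Even k → x = gamma β (w ++ (d - 1) :: maxPrefix β l k) ∧
      y = gamma β (w ++ d :: minPrefix β l k)) ∧
    (Odd k → x = gamma β (w ++ d :: minPrefix β l k) ∧
      y = gamma β (w ++ (d - 1) :: maxPrefix β l k))

/-- `(z_n)_{n ∈ ℤ}` is the increasing enumeration of `ℤ_{-β}` with `z_0 = 0`. -/
def IsEnumeration (β l : ℝ) (z : ℤ → ℝ) : Prop :=
  StrictMono z ∧ z 0 = 0 ∧ Set.range z = integers β l

/-- The bi-infinite word `v` codes the gaps of the sequence `z`. -/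
def IsCoding (β l : ℝ) (z : ℤ → ℝ) (v : ℤ → ℕ) : Prop :=
  ∀ n, IsGapOfType β l (v n) (z n) (z (n + 1))

/-- Morphisms of the free monoid `ℕ*`. -/
def IsMorphism (f : List ℕ → List ℕ) : Prop := f [] = [] ∧ ∀ u w, f (u ++ w) = f u ++ f w

/-- Antimorphisms of the free monoid `ℕ*`. -/
def IsAntimorphism (f : List ℕ → List ℕ) : Prop := f [] = [] ∧ ∀ u w, f (u ++ w) = f w ++ f u

/-- A morphism is non-erasing if no letter has empty image. -/
def NonErasing (f : List ℕ → List ℕ) : Prop := ∀ a, f [a] ≠ []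

/-- The factor `v_i v_{i+1} ⋯ v_{i+n-1}` of a bi-infinite word. -/
def factor (v : ℤ → ℕ) (i : ℤ) (n : ℕ) : List ℕ := (List.range n).map fun j : ℕ => v (i + j)

/-- `v' = ⋯f(v_{-2})f(v_{-1})|f(v_0)f(v_1)⋯`, where `|` is the place between the letters of
index `-1` and `0`: the word `f(v_0⋯v_{n-1})` stands in `v'` directly to the right of this place
and `f(v_{-n}⋯v_{-1})` directly to the left, for every `n`. For a non-erasing morphism `f` this
determines `v'`. -/
def IsImage (f : List ℕ → List ℕ) (v v' : ℤ → ℕ) : Prop :=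
  ∀ n : ℕ,
    f (factor v 0 n) = factor v' 0 (f (factor v 0 n)).length ∧
    f (factor v (-(n : ℤ)) n) =
      factor v' (-((f (factor v (-(n : ℤ)) n)).length : ℤ)) (f (factor v (-(n : ℤ)) n)).length

end NegBeta

/-!
A `(-β)`-integer is identified with a strongly admissible digit string, read as a list. Writing
`frac u` for the value of `u` to the right of the radix point, `u0^ω` is admissible exactly when
every suffix of `u` has its value in `[l, l+1)` (`admissible_iff`), the alternate order is the order
of these values (`altLT_iff`), and every `(-β)`-integer has a strongly admissible representation,
unique up to leading zeros (`mem_integers_iff`, `gamma_injOn_strongWords`). Multiplication by `-β`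
reverses the order, but it preserves betweenness, so that neighbours, gaps and walks are all
described through betweenness and no argument has to distinguish parities of lengths.

Cylinders of the transformation are intervals (`adm_append_of_mem_uIcc`). Two neighbouring
admissible words of the same length therefore have the form `w(d-1)max(k)` and `wd min(k)`, since
the intervals `[l, l+1) + e`, `e ∈ ℤ`, are disjoint and each contains an admissible point
(`exists_extremal_of_neighbours`). So every gap has a type `k`, which is the position of the
leftmost differing digit and hence unique (`diffPos_eq_of_isGapOfType`).

Multiply a gap of type `k` by `-β`. Between `w(d-1)max(k)0` and `wd min(k)0` one finds, in this
order, the words `w(d-1)s` with `s` from `max(k)0` to `max(k+1)`, then a gap of type `k+1`, then the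
words `wds` with `s` from `min(k+1)` to `min(k)0`. Since gap types do not change under prefixing,
the image of the gap is coded by `R_k (k+1)` followed by the reversal of `S_k`, read in one or the
other direction (`wordCode_gap`, `letterImage_eq_factor`). The words `R_k` and `S_k` depend only on
the extremal words because these determine the set of all admissible words of length `k+1`: a word
is admissible if and only if all its suffixes are between `min(k+1)` and `max(k+1)` in the alternate
order (`suffixBounded_eq_words`).

Finally, applying the antimorphism twice corresponds to multiplication by `β²`, which maps the
`(-β)`-integers into themselves, keeps their order and fixes `0`; this makes the coding a fixed
point (`isImage_gapAntimorphism_sq`).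
-/

namespace NegBeta

/-! ### Parameters -/

/-- The standing assumptions on the base and on the left endpoint of the domain of `T`. -/
def IsParam (β l : ℝ) : Prop :=
  1 < β ∧ l ∈ Set.Icc (-β / (β + 1)) (-1 / (β + 1))

section Param

variable {β l : ℝ}

theorem IsParam.one_lt (h : IsParam β l) : 1 < β := h.1

theorem IsParam.pos (h : IsParam β l) : 0 < β := by linarith [h.1]

theorem IsParam.neg_beta_le (h : IsParam β l) : -β ≤ l * (β + 1) := by
  have := h.2.1
  rwa [div_le_iff₀ (by linarith [h.1])] at this

theorem IsParam.le_neg_one (h : IsParam β l) : l * (β + 1) ≤ -1 := by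
  have := h.2.2
  rwa [le_div_iff₀ (by linarith [h.1])] at this

theorem IsParam.left_neg (h : IsParam β l) : l < 0 := by
  nlinarith [h.le_neg_one, h.one_lt]

theorem IsParam.right_pos (h : IsParam β l) : 0 < l + 1 := by
  nlinarith [h.neg_beta_le, h.one_lt]

theorem IsParam.zero_mem (h : IsParam β l) : (0 : ℝ) ∈ Set.Ico l (l + 1) :=
  ⟨h.left_neg.le, h.right_pos⟩

/-- Dividing by `-β` maps `[l, l + 1)` into itself, except for the point `l` when
`l = -β/(β+1)`. -/
theorem IsParam.div_mem (h : IsParam β l) {x : ℝ} (hx : x ∈ Set.Ico l (l + 1)) (hl : l < x) :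
    x / (-β) ∈ Set.Ico l (l + 1) := by
  have h1 := h.neg_beta_le
  have h2 := h.le_neg_one
  have h3 := hx.2
  rw [Set.mem_Ico, le_div_iff_of_neg (by linarith [h.pos]), div_lt_iff_of_neg (by linarith [h.pos])]
  constructor <;> nlinarith

theorem IsParam.lt_div (h : IsParam β l) {x : ℝ} (hx : x ∈ Set.Ico l (l + 1)) :
    l < x / (-β) := by
  have h2 := h.le_neg_one
  have h3 := hx.2
  rw [lt_div_iff_of_neg (by linarith [h.pos])]
  nlinarith

end Param

/-! ### Digit strings as lists -/

/-- The value `∑ a_i (-β)^{i-k}` of the digit string `a_{k-1}⋯a₀` placed directly to the right of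
the radix point. -/
noncomputable def frac (β : ℝ) : List ℤ → ℝ
  | [] => 0
  | a :: u => (a + frac β u) / (-β)

/-- Admissibility of the string `u0^ω`, in terms of lists: all suffixes of `u` have their value in
`[l, l + 1)`. -/
def Adm (β l : ℝ) : List ℤ → Prop
  | [] => True
  | a :: u => frac β (a :: u) ∈ Set.Ico l (l + 1) ∧ Adm β l u

/-- The admissible digit strings of length `n`. -/
def words (β l : ℝ) (n : ℕ) : Set (List ℤ) := {u | u.length = n ∧ Adm β l u}

section Frac

variable {β l : ℝ}

theorem frac_cons (h : IsParam β l) (a : ℤ) (u : List ℤ) :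
    -β * frac β (a :: u) = a + frac β u := by
  have := h.pos
  rw [frac]
  field_simp

theorem gamma_eq (h : IsParam β l) (u : List ℤ) :
    gamma β u = (-β) ^ u.length * frac β u := by
  induction u with
  | nil => simp [gamma, frac]
  | cons a u ih =>
    rw [gamma, ih, List.length_cons, pow_succ, mul_assoc, frac_cons h]
    ring

theorem gamma_append_singleton_zero (β : ℝ) (u : List ℤ) :
    gamma β (u ++ [0]) = -β * gamma β u := by
  induction u with
  | nil => simp [gamma]
  | cons a u ih =>
    rw [List.cons_append, gamma, ih, gamma, List.length_append, List.length_singleton]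
    ring

theorem frac_append_zeros (β : ℝ) (u : List ℤ) (j : ℕ) :
    frac β (u ++ List.replicate j 0) = frac β u := by
  induction u with
  | nil =>
    induction j with
    | zero => rfl
    | succ j ih =>
      rw [List.nil_append] at ih ⊢
      simp [List.replicate_succ, frac, ih]
  | cons a u ih => rw [List.cons_append, frac, ih, frac]

theorem Adm.frac_mem (h : IsParam β l) {u : List ℤ} (hu : Adm β l u) :
    frac β u ∈ Set.Ico l (l + 1) := by
  cases u with
  | nil => exact h.zero_mem
  | cons a u => exact hu.1

theorem adm_append_zeros (h : IsParam β l) (u : List ℤ) (j : ℕ) :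
    Adm β l (u ++ List.replicate j 0) ↔ Adm β l u := by
  induction u with
  | nil =>
    have h0 := frac_append_zeros β []
    simp only [List.nil_append] at h0 ⊢
    induction j with
    | zero => rfl
    | succ j ih =>
      have h1 := h0 (j + 1)
      rw [List.replicate_succ] at h1 ⊢
      simp only [Adm, h1, ih, and_true, iff_true]
      exact h.zero_mem
  | cons a u ih =>
    have := frac_append_zeros β (a :: u) j
    rw [List.cons_append] at this ⊢
    rw [Adm, ih, this, Adm]

theorem Adm.of_append {w u : List ℤ} (hu : Adm β l (w ++ u)) : Adm β l u := by
  induction w with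
  | nil => exact hu
  | cons a w ih => exact ih hu.2

theorem zeros_mem_words (h : IsParam β l) (n : ℕ) : List.replicate n 0 ∈ words β l n :=
  ⟨by simp, by simpa [Adm] using (adm_append_zeros h [] n)⟩

theorem append_zero_mem_words (h : IsParam β l) {n : ℕ} {u : List ℤ} (hu : u ∈ words β l n) :
    u ++ [0] ∈ words β l (n + 1) :=
  ⟨by simp [hu.1], (adm_append_zeros h u 1).2 hu.2⟩

/-- The translates of `[l, l + 1)` by integers are disjoint and ordered like the integers. -/
theorem add_lt_add_of_digit_lt {a b : ℤ} {x y : ℝ} (hx : x ∈ Set.Ico l (l + 1))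
    (hy : y ∈ Set.Ico l (l + 1)) (hab : a < b) : a + x < b + y := by
  have h1 : (a : ℝ) + 1 ≤ b := by exact_mod_cast hab
  linarith [hx.2, hy.1]

theorem digit_le_of_add_le {a b : ℤ} {x y : ℝ} (hx : x ∈ Set.Ico l (l + 1))
    (hy : y ∈ Set.Ico l (l + 1)) (hab : a + x ≤ b + y) : a ≤ b := by
  by_contra! hc
  exact absurd (add_lt_add_of_digit_lt hy hx hc) (not_lt.2 hab)

theorem digit_eq_of_add_eq {a b : ℤ} {x y : ℝ} (hx : x ∈ Set.Ico l (l + 1))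
    (hy : y ∈ Set.Ico l (l + 1)) (hab : a + x = b + y) : a = b :=
  le_antisymm (digit_le_of_add_le hx hy hab.le) (digit_le_of_add_le hy hx hab.ge)

/-- Prefixing digits reverses the order: this is the origin of the alternate order. -/
theorem frac_cons_le_iff (h : IsParam β l) (a b : ℤ) (u v : List ℤ) :
    frac β (a :: u) ≤ frac β (b :: v) ↔ b + frac β v ≤ a + frac β u := by
  rw [← frac_cons h, ← frac_cons h]
  have := h.pos
  constructor <;> intro _ <;> nlinarith

theorem frac_cons_lt_iff (h : IsParam β l) (a b : ℤ) (u v : List ℤ) :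
    frac β (a :: u) < frac β (b :: v) ↔ b + frac β v < a + frac β u := by
  rw [← not_le, frac_cons_le_iff h, not_le]

theorem frac_cons_mem_uIcc_iff (h : IsParam β l) (a b c : ℤ) (u v w : List ℤ) :
    frac β (a :: u) ∈ Set.uIcc (frac β (b :: v)) (frac β (c :: w)) ↔
      a + frac β u ∈ Set.uIcc (b + frac β v) (c + frac β w) := by
  simp only [Set.mem_uIcc, frac_cons_le_iff h]
  tauto

/-- A digit string with admissible tail is determined by its length and its value. -/
theorem eq_of_frac_eq (h : IsParam β l) {u v : List ℤ} (hl : u.length = v.length)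
    (hu : Adm β l u.tail) (hv : Adm β l v.tail) (huv : frac β u = frac β v) : u = v := by
  induction u generalizing v with
  | nil => exact (List.length_eq_zero_iff.1 hl.symm).symm
  | cons a u ih =>
    cases v with
    | nil => simp at hl
    | cons b v =>
      rw [List.tail_cons] at hu hv
      have h1 : (a : ℝ) + frac β u = b + frac β v := by rw [← frac_cons h, ← frac_cons h, huv]
      have hab := digit_eq_of_add_eq (hu.frac_mem h) (hv.frac_mem h) h1
      subst hab
      have htail : ∀ {w : List ℤ}, Adm β l w → Adm β l w.tail := by
        intro w hw
        cases w with
        | nil => exact hw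
        | cons _ _ => exact hw.2
      rw [ih (by simpa using hl) (htail hu) (htail hv) (by linarith)]

theorem Adm.tail {u : List ℤ} (hu : Adm β l u) : Adm β l u.tail := by
  cases u with
  | nil => exact hu
  | cons _ _ => exact hu.2

theorem frac_injOn_words (h : IsParam β l) (n : ℕ) : Set.InjOn (frac β) (words β l n) :=
  fun _ hu _ hv => eq_of_frac_eq h (hu.1.trans hv.1.symm) hu.2.tail hv.2.tail

theorem mem_Ico_of_mem_uIcc {a b x : ℝ} (ha : a ∈ Set.Ico l (l + 1)) (hb : b ∈ Set.Ico l (l + 1))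
    (hx : x ∈ Set.uIcc a b) : x ∈ Set.Ico l (l + 1) :=
  Set.OrdConnected.uIcc_subset Set.ordConnected_Ico ha hb hx

/-- Prefixing a word keeps the betweenness of values. -/
theorem frac_append_mem_uIcc (h : IsParam β l) (w : List ℤ) {u x v : List ℤ}
    (hx : frac β x ∈ Set.uIcc (frac β u) (frac β v)) :
    frac β (w ++ x) ∈ Set.uIcc (frac β (w ++ u)) (frac β (w ++ v)) := by
  induction w with
  | nil => exact hx
  | cons a w ih =>
    simp only [List.cons_append]
    rw [frac_cons_mem_uIcc_iff h]
    simp only [Set.mem_uIcc] at ih ⊢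
    rcases ih with ⟨h1, h2⟩ | ⟨h1, h2⟩
    · exact Or.inl ⟨by linarith, by linarith⟩
    · exact Or.inr ⟨by linarith, by linarith⟩

/-- Cylinder sets of the transformation are intervals. -/
theorem adm_append_of_mem_uIcc (h : IsParam β l) {w u x v : List ℤ} (hu : Adm β l (w ++ u))
    (hv : Adm β l (w ++ v)) (hx : Adm β l x)
    (hb : frac β x ∈ Set.uIcc (frac β u) (frac β v)) : Adm β l (w ++ x) := by
  induction w with
  | nil => exact hx
  | cons a w ih =>
    refine ⟨?_, ih hu.2 hv.2⟩
    exact mem_Ico_of_mem_uIcc hu.1 hv.1 (frac_append_mem_uIcc h (a :: w) hb)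

theorem finite_words (h : IsParam β l) (n : ℕ) : (words β l n).Finite := by
  induction n with
  | zero =>
    refine (Set.finite_singleton ([] : List ℤ)).subset ?_
    rintro u ⟨hu, -⟩
    exact List.length_eq_zero_iff.1 hu
  | succ n ih =>
    refine ((Set.finite_Icc (-⌈β + 1⌉) ⌈β + 1⌉).image2 (fun a u => a :: u) ih).subset ?_
    rintro u ⟨hl, hu⟩
    cases u with
    | nil => simp at hl
    | cons a u =>
      refine ⟨a, ?_, u, ⟨by simpa using hl, hu.2⟩, rfl⟩
      have h1 := hu.1
      have h2 := hu.2.frac_mem h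
      have h3 := frac_cons h a u
      have h4 := Int.le_ceil (β + 1)
      have h5 := h.left_neg
      have h6 := h.right_pos
      have h7 := h.pos
      have h8 : frac β (a :: u) ≤ 1 := by linarith [h1.2]
      have h9 : -1 ≤ frac β (a :: u) := by linarith [h1.1]
      constructor
      · have : (-⌈β + 1⌉ : ℝ) ≤ a := by nlinarith [h2.2]
        exact_mod_cast this
      · have : (a : ℝ) ≤ ⌈β + 1⌉ := by nlinarith [h2.1]
        exact_mod_cast this

end Frac

/-! ### Expansions -/

section Expansion

variable {β l : ℝ}

theorem T_mem (β l x : ℝ) : T β l x ∈ Set.Ico l (l + 1) := by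
  have h1 := Int.floor_le (-β * x - l)
  have h2 := Int.lt_floor_add_one (-β * x - l)
  constructor <;> rw [T] <;> linarith

theorem expansion_zero (β l x : ℝ) : expansion β l x 0 = ⌊-β * x - l⌋ := rfl

theorem expansion_succ (β l x : ℝ) (i : ℕ) :
    expansion β l x (i + 1) = expansion β l (T β l x) i := rfl

/-- Only `0` has the expansion `0^ω`: otherwise the iterates of `T` would grow like `β^i`. -/
theorem eq_zero_of_expansion_eq_zero (h : IsParam β l) {x : ℝ} (hx : x ∈ Set.Ico l (l + 1))
    (h0 : ∀ i, expansion β l x i = 0) : x = 0 := by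
  have hit : ∀ i : ℕ, (T β l)^[i] x = (-β) ^ i * x ∧ (T β l)^[i] x ∈ Set.Ico l (l + 1) := by
    intro i
    induction i with
    | zero => exact ⟨by simp, hx⟩
    | succ i ih =>
      rw [Function.iterate_succ_apply']
      refine ⟨?_, T_mem _ _ _⟩
      have h1 : ⌊-β * (T β l)^[i] x - l⌋ = 0 := h0 i
      rw [T, h1, ih.1]
      push_cast
      ring
  by_contra hne
  obtain ⟨n, hn⟩ := pow_unbounded_of_one_lt (1 / |x|) h.one_lt
  have h1 := hit n
  rw [h1.1] at h1
  have h2 : |(-β) ^ n * x| ≤ 1 :=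
    abs_le.2 ⟨by linarith [h1.2.1, h.right_pos], by linarith [h1.2.2, h.left_neg]⟩
  rw [abs_mul, abs_pow, abs_neg, abs_of_pos h.pos] at h2
  rw [div_lt_iff₀ (abs_pos.2 hne)] at hn
  linarith

theorem padZero_nil (i : ℕ) : padZero [] i = 0 := by simp [padZero]

theorem padZero_cons_zero (a : ℤ) (u : List ℤ) : padZero (a :: u) 0 = a := by simp [padZero]

theorem padZero_cons_succ (a : ℤ) (u : List ℤ) (i : ℕ) :
    padZero (a :: u) (i + 1) = padZero u i := by simp [padZero]

theorem adm_of_expansion_eq (h : IsParam β l) {u : List ℤ} {x : ℝ} (hx : x ∈ Set.Ico l (l + 1))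
    (hu : padZero u = expansion β l x) : x = frac β u ∧ Adm β l u := by
  induction u generalizing x with
  | nil =>
    exact ⟨eq_zero_of_expansion_eq_zero h hx fun i => by rw [← hu, padZero_nil], trivial⟩
  | cons a u ih =>
    have h0 : a = ⌊-β * x - l⌋ := by rw [← expansion_zero, ← hu, padZero_cons_zero]
    obtain ⟨h1, h2⟩ := ih (T_mem β l x) (by
      funext i
      rw [← expansion_succ, ← hu, padZero_cons_succ])
    have h3 : x = frac β (a :: u) := by
      have := frac_cons h a u
      rw [← h1, T, ← h0] at this
      have h4 : -β * frac β (a :: u) = -β * x := by linarith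
      exact (mul_left_cancel₀ (by linarith [h.pos]) h4).symm
    exact ⟨h3, h3 ▸ hx, h2⟩

theorem expansion_frac (h : IsParam β l) {u : List ℤ} (hu : Adm β l u) :
    padZero u = expansion β l (frac β u) := by
  induction u with
  | nil =>
    have hT : T β l 0 = 0 := by
      have : ⌊-β * 0 - l⌋ = 0 := by
        rw [Int.floor_eq_iff]; constructor <;> push_cast <;> linarith [h.left_neg, h.right_pos]
      rw [T, this]; simp
    funext i
    have h1 : (T β l)^[i] 0 = 0 := Function.iterate_fixed hT i
    have : ⌊-β * 0 - l⌋ = 0 := by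
      rw [Int.floor_eq_iff]; constructor <;> push_cast <;> linarith [h.left_neg, h.right_pos]
    rw [padZero_nil, expansion, frac, h1, this]
  | cons a u ih =>
    have hm := hu.2.frac_mem h
    have h1 : ⌊-β * frac β (a :: u) - l⌋ = a := by
      rw [frac_cons h, Int.floor_eq_iff]
      constructor <;> linarith [hm.1, hm.2]
    funext i
    cases i with
    | zero => rw [padZero_cons_zero, expansion_zero, h1]
    | succ i =>
      rw [padZero_cons_succ, expansion_succ, ih hu.2]
      congr 1
      rw [T, h1, frac_cons h]
      ring

theorem admissible_iff (h : IsParam β l) (u : List ℤ) :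
    Admissible β l (padZero u) ↔ Adm β l u :=
  ⟨fun ⟨_, hx, hu⟩ => (adm_of_expansion_eq h hx hu).2,
    fun hu => ⟨frac β u, hu.frac_mem h, expansion_frac h hu⟩⟩

theorem stronglyAdmissible_iff (h : IsParam β l) (u : List ℤ) :
    StronglyAdmissible β l (padZero u) ↔ Adm β l (0 :: u) := by
  rw [← admissible_iff h, StronglyAdmissible]
  congr! 1
  funext i
  cases i with
  | zero => rw [padZero_cons_zero, zeroCons]
  | succ i => rw [padZero_cons_succ, zeroCons]

end Expansion

/-! ### Alternate order and extremal strings -/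

section Alt

variable {β l : ℝ}

theorem altLT_cons_iff (a b : ℤ) (u v : List ℤ) :
    AltLT (padZero (a :: u)) (padZero (b :: v)) ↔
      b < a ∨ a = b ∧ AltLT (padZero v) (padZero u) := by
  constructor
  · rintro ⟨m, h1, h2⟩
    cases m with
    | zero =>
      left
      simpa [padZero_cons_zero] using h2
    | succ m =>
      right
      refine ⟨by simpa [padZero_cons_zero] using h1 0 (by omega), m, fun i hi => ?_, ?_⟩
      · simpa [padZero_cons_succ] using (h1 (i + 1) (by omega)).symm
      · simp only [padZero_cons_succ, pow_succ _ (m + 1)] at h2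
        linarith
  · rintro (hab | ⟨rfl, m, h1, h2⟩)
    · refine ⟨0, fun i hi => by omega, ?_⟩
      simpa [padZero_cons_zero] using hab
    · refine ⟨m + 1, fun i hi => ?_, ?_⟩
      · cases i with
        | zero => rfl
        | succ i => simpa [padZero_cons_succ] using (h1 i (by omega)).symm
      · simp only [padZero_cons_succ, pow_succ _ (m + 1)]
        linarith

theorem altLT_nil_nil : ¬ AltLT (padZero []) (padZero []) := by
  rintro ⟨m, -, h⟩
  exact lt_irrefl _ h

/-- The alternate order is the order of the values. -/
theorem altLT_iff (h : IsParam β l) {u v : List ℤ} (hl : u.length = v.length)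
    (hu : Adm β l u.tail) (hv : Adm β l v.tail) :
    AltLT (padZero u) (padZero v) ↔ frac β u < frac β v := by
  obtain ⟨n, hn⟩ : ∃ n, u.length = n := ⟨_, rfl⟩
  induction n generalizing u v with
  | zero =>
    obtain rfl := List.length_eq_zero_iff.1 hn
    obtain rfl := List.length_eq_zero_iff.1 (hl.symm.trans hn)
    simp [altLT_nil_nil]
  | succ n ih =>
    match u, v, hl with
    | [], _, _ => simp at hn
    | a :: u, b :: v, hl =>
      rw [List.tail_cons] at hu hv
      have hum := hu.frac_mem h
      have hvm := hv.frac_mem h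
      have hl' : u.length = v.length := by simpa using hl
      have hn' : u.length = n := by simpa using hn
      rw [altLT_cons_iff, frac_cons_lt_iff h]
      rcases lt_trichotomy a b with hab | rfl | hab
      · have := add_lt_add_of_digit_lt hum hvm hab
        constructor
        · rintro (h1 | ⟨h1, -⟩) <;> omega
        · intro h1; linarith
      · simp [ih hl'.symm hv.tail hu.tail (hl'.symm.trans hn')]
      · have := add_lt_add_of_digit_lt hvm hum hab
        simp [hab, this]

theorem padZero_injective_of_length_eq {u v : List ℤ} (hl : u.length = v.length)
    (huv : padZero u = padZero v) : u = v := by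
  refine List.ext_getElem hl fun i h1 h2 => ?_
  have := congrFun huv i
  simpa [padZero, List.getD_eq_getElem?_getD, h1, h2] using this

theorem altLE_iff (h : IsParam β l) {u v : List ℤ} (hl : u.length = v.length)
    (hu : Adm β l u.tail) (hv : Adm β l v.tail) :
    AltLE (padZero u) (padZero v) ↔ frac β u ≤ frac β v := by
  rw [AltLE, altLT_iff h hl hu hv, le_iff_eq_or_lt]
  refine or_congr_left ⟨fun huv => ?_, fun huv => ?_⟩
  · rw [padZero_injective_of_length_eq hl huv]
  · rw [eq_of_frac_eq h hl hu hv huv]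

theorem padZero_append_zeros (u : List ℤ) (j : ℕ) :
    padZero (u ++ List.replicate j 0) = padZero u := by
  funext i
  rw [padZero, padZero, List.getD_eq_getElem?_getD, List.getD_eq_getElem?_getD]
  by_cases hi : i < u.length
  · rw [List.getElem?_append_left hi]
  · rw [List.getElem?_append_right (not_lt.1 hi), List.getElem?_eq_none (not_lt.1 hi),
      List.getElem?_replicate]
    split_ifs <;> rfl

theorem mem_stringSet_iff (h : IsParam β l) (k : ℕ) (s : ℕ → ℤ) :
    s ∈ stringSet β l k ↔ ∃ u ∈ words β l k, padZero u = s := by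
  constructor
  · rintro ⟨hs, h0⟩
    have hpad : padZero ((List.range k).map s) = s := by
      funext i
      rw [padZero, List.getD_eq_getElem?_getD, List.getElem?_map]
      by_cases hi : i < k
      · rw [List.getElem?_range hi]; rfl
      · rw [List.getElem?_eq_none (by simpa using hi), h0 i (not_lt.1 hi)]; rfl
    exact ⟨_, ⟨by simp, (admissible_iff h _).1 (by rw [hpad]; exact hs)⟩, hpad⟩
  · rintro ⟨u, ⟨hl, hu⟩, rfl⟩
    refine ⟨(admissible_iff h _).2 hu, fun i hi => ?_⟩
    rw [padZero, List.getD_eq_default _ _ (by omega)]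

theorem map_range_padZero {u : List ℤ} {k : ℕ} (hu : u.length = k) :
    (List.range k).map (padZero u) = u := by
  refine List.ext_getElem (by simp [hu]) fun i h1 h2 => ?_
  simp [padZero, List.getD_eq_getElem?_getD, h2]

/-- `max(k)` is the admissible word of length `k` with the greatest value. -/
theorem maxPrefix_spec (h : IsParam β l) (k : ℕ) :
    maxPrefix β l k ∈ words β l k ∧
      ∀ u ∈ words β l k, frac β u ≤ frac β (maxPrefix β l k) := by
  have hex : ∃ s, s ∈ stringSet β l k ∧ ∀ t ∈ stringSet β l k, AltLE t s := by
    obtain ⟨M, hM, hmax⟩ := Set.exists_max_image _ (frac β) (finite_words h k)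
      ⟨_, zeros_mem_words h k⟩
    refine ⟨padZero M, (mem_stringSet_iff h k _).2 ⟨M, hM, rfl⟩, fun t ht => ?_⟩
    obtain ⟨u, hu, rfl⟩ := (mem_stringSet_iff h k _).1 ht
    exact (altLE_iff h (hu.1.trans hM.1.symm) hu.2.tail hM.2.tail).2 (hmax u hu)
  obtain ⟨h1, h2⟩ := Classical.epsilon_spec hex
  obtain ⟨M, hM, hMs⟩ := (mem_stringSet_iff h k _).1 h1
  have h3 : maxPrefix β l k = M := by
    rw [maxPrefix, maxString, ← hMs, map_range_padZero hM.1]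
  rw [h3]
  refine ⟨hM, fun u hu => ?_⟩
  have h4 := h2 _ ((mem_stringSet_iff h k _).2 ⟨u, hu, rfl⟩)
  rw [← hMs] at h4
  exact (altLE_iff h (hu.1.trans hM.1.symm) hu.2.tail hM.2.tail).1 h4

/-- `min(k)` is the admissible word of length `k` with the least value. -/
theorem minPrefix_spec (h : IsParam β l) (k : ℕ) :
    minPrefix β l k ∈ words β l k ∧
      ∀ u ∈ words β l k, frac β (minPrefix β l k) ≤ frac β u := by
  have hex : ∃ s, s ∈ stringSet β l k ∧ ∀ t ∈ stringSet β l k, AltLE s t := by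
    obtain ⟨M, hM, hmin⟩ := Set.exists_min_image _ (frac β) (finite_words h k)
      ⟨_, zeros_mem_words h k⟩
    refine ⟨padZero M, (mem_stringSet_iff h k _).2 ⟨M, hM, rfl⟩, fun t ht => ?_⟩
    obtain ⟨u, hu, rfl⟩ := (mem_stringSet_iff h k _).1 ht
    exact (altLE_iff h (hM.1.trans hu.1.symm) hM.2.tail hu.2.tail).2 (hmin u hu)
  obtain ⟨h1, h2⟩ := Classical.epsilon_spec hex
  obtain ⟨M, hM, hMs⟩ := (mem_stringSet_iff h k _).1 h1
  have h3 : minPrefix β l k = M := by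
    rw [minPrefix, minString, ← hMs, map_range_padZero hM.1]
  rw [h3]
  refine ⟨hM, fun u hu => ?_⟩
  have h4 := h2 _ ((mem_stringSet_iff h k _).2 ⟨u, hu, rfl⟩)
  rw [← hMs] at h4
  exact (altLE_iff h (hM.1.trans hu.1.symm) hM.2.tail hu.2.tail).1 h4

/-- The strings of length `n` all of whose suffixes lie, in the alternate order, between the
strings given by `c` and `d`. -/
def suffixBounded (n : ℕ) (c d : List ℤ) : Set (List ℤ) :=
  {u | u.length = n ∧ ∀ s, s <:+ u →
    AltLE (padZero c) (padZero s) ∧ AltLE (padZero s) (padZero d)}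

/-- The admissible strings of length `n` are determined by the extremal ones among them. A string
`as` with `s` admissible is itself admissible as soon as its value lies between two admissible
ones, and this can be seen from the alternate order. -/
theorem suffixBounded_eq_words (h : IsParam β l) (n : ℕ) :
    suffixBounded n (minPrefix β l n) (maxPrefix β l n) = words β l n := by
  obtain ⟨hm, hmin⟩ := minPrefix_spec h n
  obtain ⟨hM, hmax⟩ := maxPrefix_spec h n
  -- padding with zeros reduces the comparison to words of equal length
  have key : ∀ s : List ℤ, s.length ≤ n → Adm β l s.tail →
      (AltLE (padZero (minPrefix β l n)) (padZero s) ∧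
        AltLE (padZero s) (padZero (maxPrefix β l n)) ↔
      frac β (minPrefix β l n) ≤ frac β s ∧ frac β s ≤ frac β (maxPrefix β l n)) := by
    intro s hs hst
    have hlen : (s ++ List.replicate (n - s.length) 0).length = n := by simp; omega
    have htl : Adm β l (s ++ List.replicate (n - s.length) 0).tail := by
      cases s with
      | nil => exact (zeros_mem_words h _).2.tail
      | cons a s => exact (adm_append_zeros h s _).2 hst
    rw [← padZero_append_zeros s (n - s.length), ← frac_append_zeros β s (n - s.length),
      altLE_iff h (hm.1.trans hlen.symm) hm.2.tail htl,
      altLE_iff h (hlen.trans hM.1.symm) htl hM.2.tail]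
  ext u
  constructor
  · rintro ⟨hl, hu⟩
    refine ⟨hl, ?_⟩
    have hl' := hl.le
    clear hl
    induction u with
    | nil => trivial
    | cons a u ih =>
      have h1 : Adm β l u := ih (fun s hs => hu s (hs.trans (List.suffix_cons a u)))
        (by simp at hl'; omega)
      have h2 := (key (a :: u) hl' h1).1 (hu _ List.suffix_rfl)
      exact ⟨⟨(hm.2.frac_mem h).1.trans h2.1, h2.2.trans_lt (hM.2.frac_mem h).2⟩, h1⟩
  · rintro ⟨hl, hu⟩
    refine ⟨hl, fun s hs => ?_⟩
    have hsl := hs.length_le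
    obtain ⟨w, rfl⟩ := hs
    have hsa : Adm β l s := hu.of_append
    refine (key s (by omega) hsa.tail).2 ?_
    have hs' : s ++ List.replicate (n - s.length) 0 ∈ words β l n :=
      ⟨by simp; omega, (adm_append_zeros h s _).2 hsa⟩
    rw [← frac_append_zeros β s (n - s.length)]
    exact ⟨hmin _ hs', hmax _ hs'⟩

end Alt

/-! ### Codes of walks in an ordered set -/

/-- The position, counted from the right and starting with `0`, of the leftmost difference of two
words of equal length; the value is `0` if they do not differ. -/
def diffPos : List ℤ → List ℤ → ℕ
  | a :: u, b :: v => if a = b then diffPos u v else u.length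
  | _, _ => 0

/-- `Code B X c s t W`: walking from `s` to `t` through the points of `X`, each time going to the
nearest point on the way to `t`, one reads the colours `W` of the steps. The relation `B s x t`
means that `x` is between `s` and `t`; since betweenness does not see the direction of an order,
codes survive order-reversing maps. -/
inductive Code {α : Type*} (B : α → α → α → Prop) (X : Set α) (c : α → α → ℕ) :
    α → α → List ℕ → Prop
  | nil (s : α) : Code B X c s s []
  | cons {s s₁ t : α} {W : List ℕ} : s₁ ∈ X → s₁ ≠ s → B s s₁ t →
      (∀ x ∈ X, B s x s₁ → x = s ∨ x = s₁) → Code B X c s₁ t W →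
      Code B X c s t (c s s₁ :: W)

theorem Code.congr {α : Type*} {B B' : α → α → α → Prop} {X : Set α} {c : α → α → ℕ}
    (hB : ∀ s ∈ X, ∀ x ∈ X, ∀ t ∈ X, (B s x t ↔ B' s x t)) {s t : α} {W : List ℕ}
    (hs : s ∈ X) (ht : t ∈ X) (hc : Code B X c s t W) : Code B' X c s t W := by
  induction hc with
  | nil s => exact .nil s
  | cons h1 h2 h3 h4 _ ih =>
    exact .cons h1 h2 ((hB _ hs _ h1 _ ht).1 h3)
      (fun x hx hb => h4 x hx ((hB _ hs _ hx _ h1).2 hb)) (ih h1 ht)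

section Real

variable {α : Type*} {f : α → ℝ} {X : Set α} {c : α → α → ℕ} {s t u : α} {W W' : List ℕ}

/-- Betweenness with respect to a real-valued function. -/
def valueBtw (f : α → ℝ) (s x t : α) : Prop := f x ∈ Set.uIcc (f s) (f t)

theorem Code.unique (hf : Set.InjOn f X) (hs : s ∈ X) (h : Code (valueBtw f) X c s t W)
    (h' : Code (valueBtw f) X c s t W') : W = W' := by
  induction h generalizing W' with
  | nil s =>
    cases h' with
    | nil => rfl
    | cons h1 h2 h3 h4 _ =>
      exact absurd (hf h1 hs (by simpa [valueBtw] using h3)) h2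
  | @cons s s₁ t W h1 h2 h3 h4 _ ih =>
    cases h' with
    | nil => exact absurd (hf h1 hs (by simpa [valueBtw] using h3)) h2
    | @cons _ s₁' _ W' h1' h2' h3' h4' h5' =>
      have key : valueBtw f s s₁ s₁' ∨ valueBtw f s s₁' s₁ := by
        simp only [valueBtw, Set.mem_uIcc] at h3 h3' ⊢
        rcases le_total (f s₁) (f s₁') with hle | hle <;> grind
      have heq : s₁ = s₁' := by
        rcases key with hk | hk
        · exact (h4' _ h1 hk).resolve_left h2
        · exact ((h4 _ h1' hk).resolve_left h2').symm
      subst heq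
      rw [ih h1 h5']

theorem Code.append (h : Code (valueBtw f) X c s t W) (h' : Code (valueBtw f) X c t u W')
    (hb : valueBtw f s t u) : Code (valueBtw f) X c s u (W ++ W') := by
  induction h with
  | nil s => exact h'
  | @cons s s₁ t W h1 h2 h3 h4 _ ih =>
    simp only [valueBtw, Set.mem_uIcc] at h3 hb
    refine .cons h1 h2 ?_ h4 (ih h' ?_) <;> simp only [valueBtw, Set.mem_uIcc] <;> grind

theorem Code.reverse (hc : ∀ x ∈ X, ∀ y ∈ X, c x y = c y x) (hs : s ∈ X)
    (h : Code (valueBtw f) X c s t W) : Code (valueBtw f) X c t s W.reverse := by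
  induction h with
  | nil s => exact .nil s
  | @cons s s₁ t W h1 h2 h3 h4 _ ih =>
    have hstep : Code (valueBtw f) X c s₁ s [c s s₁] := by
      rw [hc _ hs _ h1]
      refine .cons hs h2.symm Set.right_mem_uIcc (fun x hx hb => (h4 x hx ?_).symm) (.nil s)
      rwa [valueBtw, Set.uIcc_comm]
    rw [List.reverse_cons]
    refine (ih h1).append hstep ?_
    rwa [valueBtw, Set.uIcc_comm]

theorem Code.exists (hX : X.Finite) (hf : Set.InjOn f X) (hs : s ∈ X) (ht : t ∈ X) :
    ∃ W, Code (valueBtw f) X c s t W := by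
  obtain ⟨n, hn⟩ : ∃ n, {x ∈ X | valueBtw f s x t}.ncard = n := ⟨_, rfl⟩
  induction n using Nat.strong_induction_on generalizing s with
  | _ n ih =>
    by_cases hst : s = t
    · exact ⟨[], hst ▸ .nil s⟩
    -- the first step leads to the nearest point on the way
    obtain ⟨s₁, ⟨h1, h2, h3⟩, hmin⟩ := Set.exists_min_image
      {x ∈ X | x ≠ s ∧ valueBtw f s x t} (fun x => |f x - f s|) (hX.subset (Set.sep_subset _ _))
      ⟨t, ht, Ne.symm hst, Set.right_mem_uIcc⟩
    have hne : f s₁ ≠ f s := fun he => h2 (hf h1 hs he)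
    have hlt : {x ∈ X | valueBtw f s₁ x t}.ncard < n := by
      rw [← hn]
      refine Set.ncard_lt_ncard ?_ (hX.subset (Set.sep_subset _ _))
      refine ⟨fun x hx => ⟨hx.1, ?_⟩, fun hsub => ?_⟩
      · have hx2 := hx.2
        simp only [valueBtw, Set.mem_uIcc] at h3 hx2 ⊢
        grind
      · have h5 := (hsub ⟨hs, Set.left_mem_uIcc⟩ : s ∈ {x ∈ X | valueBtw f s₁ x t}).2
        simp only [valueBtw, Set.mem_uIcc] at h3 h5
        grind
    obtain ⟨W, hW⟩ := ih _ hlt h1 rfl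
    refine ⟨_, .cons h1 h2 h3 (fun x hx hb => ?_) hW⟩
    by_contra! hcon
    have hfx : f x ≠ f s₁ := fun he => hcon.2 (hf hx h1 he)
    have h6 : valueBtw f s x t := by
      simp only [valueBtw, Set.mem_uIcc] at h3 hb ⊢
      grind
    have h7 := hmin x ⟨hx, hcon.1, h6⟩
    simp only [valueBtw, Set.mem_uIcc] at hb
    rcases hb with hb | hb
    · rw [abs_of_nonneg (by linarith), abs_of_nonneg (by linarith)] at h7
      exact hfx (by linarith)
    · rw [abs_of_nonpos (by linarith), abs_of_nonpos (by linarith)] at h7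
      exact hfx (by linarith)

end Real

/-! ### Position of the leftmost difference -/

theorem diffPos_cons (a : ℤ) (u v : List ℤ) : diffPos (a :: u) (a :: v) = diffPos u v := by
  simp [diffPos]

theorem diffPos_append (w u v : List ℤ) : diffPos (w ++ u) (w ++ v) = diffPos u v := by
  induction w with
  | nil => rfl
  | cons a w ih => rw [List.cons_append, List.cons_append, diffPos_cons, ih]

theorem diffPos_cons_of_ne {a b : ℤ} (hab : a ≠ b) (u v : List ℤ) :
    diffPos (a :: u) (b :: v) = u.length := by
  simp [diffPos, hab]

theorem diffPos_comm {u v : List ℤ} (hl : u.length = v.length) : diffPos u v = diffPos v u := by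
  induction u generalizing v with
  | nil => obtain rfl := List.length_eq_zero_iff.1 hl.symm; rfl
  | cons a u ih =>
    cases v with
    | nil => simp at hl
    | cons b v =>
      have hl' : u.length = v.length := by simpa using hl
      by_cases hab : a = b
      · subst hab
        rw [diffPos_cons, diffPos_cons, ih hl']
      · rw [diffPos_cons_of_ne hab, diffPos_cons_of_ne (Ne.symm hab), hl']

/-- Betweenness for the alternate order. -/
def altBtw (s x t : List ℤ) : Prop :=
  AltLE (padZero s) (padZero x) ∧ AltLE (padZero x) (padZero t) ∨
    AltLE (padZero t) (padZero x) ∧ AltLE (padZero x) (padZero s)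

/-! ### Codes of admissible words -/

/-- Codes in the set of admissible words of length `n`, ordered by their values; the colour of a
step is the position of the leftmost digit that changes. -/
def WordCode (β l : ℝ) (n : ℕ) : List ℤ → List ℤ → List ℕ → Prop :=
  Code (valueBtw (frac β)) (words β l n) diffPos

/-- The code from `s` to `t` in the set of admissible words of length `n`, computed from the
extremal words `c` and `d` of that set and from the alternate order only. -/
noncomputable def codeWord (n : ℕ) (c d s t : List ℤ) : List ℕ :=
  Classical.epsilon fun W => Code altBtw (suffixBounded n c d) diffPos s t W

/-- The word `R_k` as a function of `k`, `min(k)`, `max(k)`, `min(k+1)`, `max(k+1)`: the code from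
`max(k)0` to `max(k+1)`. -/
noncomputable def wordR (k : ℕ) (_ b c d : List ℤ) : List ℕ :=
  codeWord (k + 1) c d (b ++ [0]) d

/-- The word `S_k` as a function of `k`, `min(k)`, `max(k)`, `min(k+1)`, `max(k+1)`: the code from
`min(k)0` to `min(k+1)`. -/
noncomputable def wordS (k : ℕ) (a _ c d : List ℤ) : List ℕ :=
  codeWord (k + 1) c d (a ++ [0]) c

section

variable {β l : ℝ} {n : ℕ} {s t u v w : List ℤ} {W W' : List ℕ}

theorem valueBtw_frac_iff_altBtw (h : IsParam β l) (hs : s ∈ words β l n) (hu : u ∈ words β l n)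
    (ht : t ∈ words β l n) : valueBtw (frac β) s u t ↔ altBtw s u t := by
  rw [valueBtw, altBtw, Set.mem_uIcc, altLE_iff h (hs.1.trans hu.1.symm) hs.2.tail hu.2.tail,
    altLE_iff h (hu.1.trans ht.1.symm) hu.2.tail ht.2.tail,
    altLE_iff h (ht.1.trans hu.1.symm) ht.2.tail hu.2.tail,
    altLE_iff h (hu.1.trans hs.1.symm) hu.2.tail hs.2.tail]

/-- `codeWord`, which does not refer to `β` and `l`, yields the code of admissible words as soon as
it is given the extremal words. -/
theorem wordCode_codeWord (h : IsParam β l) (hs : s ∈ words β l n) (ht : t ∈ words β l n) :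
    WordCode β l n s t (codeWord n (minPrefix β l n) (maxPrefix β l n) s t) := by
  obtain ⟨W, hW⟩ := Code.exists (c := diffPos) (finite_words h n) (frac_injOn_words h n) hs ht
  rw [codeWord, suffixBounded_eq_words h]
  refine Code.congr (fun s hs x hx t ht => (valueBtw_frac_iff_altBtw h hs hx ht).symm) hs ht ?_
  exact Classical.epsilon_spec (p := fun W => Code altBtw (words β l n) diffPos s t W)
    ⟨W, Code.congr (fun s hs x hx t ht => valueBtw_frac_iff_altBtw h hs hx ht) hs ht hW⟩

theorem WordCode.unique (h : IsParam β l) (hs : s ∈ words β l n) (hW : WordCode β l n s t W)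
    (hW' : WordCode β l n s t W') : W = W' :=
  Code.unique (frac_injOn_words h n) hs hW hW'

theorem WordCode.reverse (hs : s ∈ words β l n) (hW : WordCode β l n s t W) :
    WordCode β l n t s W.reverse :=
  Code.reverse (fun _ hx _ hy => diffPos_comm (hx.1.trans hy.1.symm)) hs hW

theorem valueBtw_cons_iff (h : IsParam β l) (a : ℤ) (s x t : List ℤ) :
    valueBtw (frac β) (a :: s) (a :: x) (a :: t) ↔ valueBtw (frac β) s x t := by
  simp only [valueBtw, Set.mem_uIcc, frac_cons_le_iff h, add_le_add_iff_left]
  tauto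

/-- A word with value between two words starting with the same digit starts with that digit. -/
theorem exists_cons_of_valueBtw (h : IsParam β l) {a : ℤ} (hs : Adm β l s) (ht : Adm β l t)
    (hu : u ∈ words β l (n + 1)) (hb : valueBtw (frac β) (a :: s) u (a :: t)) :
    ∃ x ∈ words β l n, u = a :: x := by
  obtain ⟨hl, hu⟩ := hu
  cases u with
  | nil => simp at hl
  | cons e x =>
    have hx := hu.2.frac_mem h
    rw [valueBtw, frac_cons_mem_uIcc_iff h, Set.mem_uIcc] at hb
    have : e = a := by
      rcases hb with ⟨h1, h2⟩ | ⟨h1, h2⟩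
      · exact le_antisymm (digit_le_of_add_le hx (ht.frac_mem h) h2)
          (digit_le_of_add_le (hs.frac_mem h) hx h1)
      · exact le_antisymm (digit_le_of_add_le hx (hs.frac_mem h) h2)
          (digit_le_of_add_le (ht.frac_mem h) hx h1)
    subst this
    exact ⟨x, ⟨by simpa using hl, hu.2⟩, rfl⟩

theorem WordCode.cons (h : IsParam β l) (a : ℤ) (hW : WordCode β l n s t W)
    (hs : s ∈ words β l n) (ht : t ∈ words β l n) (has : Adm β l (a :: s))
    (hat : Adm β l (a :: t)) : WordCode β l (n + 1) (a :: s) (a :: t) W := by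
  induction hW with
  | nil s => exact .nil _
  | @cons s s₁ t W h1 h2 h3 h4 _ ih =>
    have ha1 : Adm β l (a :: s₁) := adm_append_of_mem_uIcc h (w := [a]) has hat h1.2 h3
    rw [← diffPos_cons a s s₁]
    refine Code.cons ⟨by simp [h1.1], ha1⟩ (by simpa using h2) ((valueBtw_cons_iff h a _ _ _).2 h3)
      (fun x hx hb => ?_) (ih h1 ht ha1 hat)
    obtain ⟨y, hy, rfl⟩ := exists_cons_of_valueBtw h hs.2 h1.2 hx hb
    simpa using h4 y hy ((valueBtw_cons_iff h a _ _ _).1 hb)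

theorem WordCode.append_left (h : IsParam β l) (w : List ℤ) (hW : WordCode β l n s t W)
    (hs : s ∈ words β l n) (ht : t ∈ words β l n) (hws : Adm β l (w ++ s))
    (hwt : Adm β l (w ++ t)) : WordCode β l (w.length + n) (w ++ s) (w ++ t) W := by
  induction w with
  | nil => simpa using hW
  | cons a w ih =>
    have h1 := (ih hws.2 hwt.2).cons h a ⟨by simp [hs.1], hws.2⟩ ⟨by simp [ht.1], hwt.2⟩ hws hwt
    have h2 : (a :: w).length + n = w.length + n + 1 := by simp; omega
    rw [h2]
    exact h1

/-- Between `(d-1)max(k)` and `d min(k)` there is no admissible word. -/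
theorem eq_or_eq_of_valueBtw_extremal (h : IsParam β l) (n : ℕ) (d : ℤ)
    (hu : u ∈ words β l (n + 1))
    (hb : valueBtw (frac β) ((d - 1) :: maxPrefix β l n) u (d :: minPrefix β l n)) :
    u = (d - 1) :: maxPrefix β l n ∨ u = d :: minPrefix β l n := by
  obtain ⟨hm, hmin⟩ := minPrefix_spec h n
  obtain ⟨hM, hmax⟩ := maxPrefix_spec h n
  obtain ⟨hl, hu⟩ := hu
  cases u with
  | nil => simp at hl
  | cons e x =>
    have hx : x ∈ words β l n := ⟨by simpa using hl, hu.2⟩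
    have hxm := hu.2.frac_mem h
    have hlt := add_lt_add_of_digit_lt (hM.2.frac_mem h) (hm.2.frac_mem h) (sub_one_lt d)
    rw [valueBtw, frac_cons_mem_uIcc_iff h, Set.uIcc_of_le hlt.le] at hb
    have h1 := digit_le_of_add_le (hM.2.frac_mem h) hxm hb.1
    have h2 := digit_le_of_add_le hxm (hm.2.frac_mem h) hb.2
    rcases (by omega : e = d - 1 ∨ e = d) with rfl | rfl
    · left
      rw [frac_injOn_words h n hx hM (le_antisymm (hmax x hx) (by linarith [hb.1]))]
    · right
      rw [frac_injOn_words h n hx hm (le_antisymm (by linarith [hb.2]) (hmin x hx))]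

/-- Two neighbouring admissible words of length `n` are of the form `w(d-1)max(k)` and
`wd min(k)`. -/
theorem exists_extremal_of_neighbours (h : IsParam β l) (hu : u ∈ words β l n)
    (hv : v ∈ words β l n) (huv : u ≠ v)
    (hb : ∀ x ∈ words β l n, valueBtw (frac β) u x v → x = u ∨ x = v) :
    ∃ (w : List ℤ) (d : ℤ) (k : ℕ),
      u = w ++ (d - 1) :: maxPrefix β l k ∧ v = w ++ d :: minPrefix β l k ∨
      v = w ++ (d - 1) :: maxPrefix β l k ∧ u = w ++ d :: minPrefix β l k := by
  induction n generalizing u v with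
  | zero =>
    exact absurd ((List.length_eq_zero_iff.1 hu.1).trans (List.length_eq_zero_iff.1 hv.1).symm) huv
  | succ n ih =>
    match u, v, hu, hv with
    | [], _, hu, _ => exact absurd hu.1 (by simp)
    | _, [], _, hv => exact absurd hv.1 (by simp)
    | a :: u, b :: v, hu, hv =>
      have hu' : u ∈ words β l n := ⟨by simpa using hu.1, hu.2.2⟩
      have hv' : v ∈ words β l n := ⟨by simpa using hv.1, hv.2.2⟩
      by_cases hab : a = b
      · subst hab
        obtain ⟨w, d, k, hw⟩ := ih hu' hv' (by simpa using huv) (fun x hx hxb => by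
          have hax : Adm β l (a :: x) := adm_append_of_mem_uIcc h (w := [a]) hu.2 hv.2 hx.2 hxb
          simpa using hb (a :: x) ⟨by simp [hx.1], hax⟩ ((valueBtw_cons_iff h a _ _ _).2 hxb))
        refine ⟨a :: w, d, k, ?_⟩
        simpa using hw
      · clear ih
        wlog hlt : a < b generalizing u v a b
        · obtain ⟨w, d, k, hw⟩ := this b v a u hv hu huv.symm (fun x hx hxb =>
            (hb x hx (by rwa [valueBtw, Set.uIcc_comm])).symm) hv' hu' (Ne.symm hab)
            (lt_of_le_of_ne (not_lt.1 hlt) (Ne.symm hab))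
          exact ⟨w, d, k, hw.symm⟩
        obtain ⟨hm, hmin⟩ := minPrefix_spec h n
        obtain ⟨hM, hmax⟩ := maxPrefix_spec h n
        have hum := hu'.2.frac_mem h
        have hvm := hv'.2.frac_mem h
        have huvlt := add_lt_add_of_digit_lt hum hvm hlt
        -- no `e + x` with `x` the value of an admissible word is strictly between the end points
        have key : ∀ (e : ℤ), ∀ x ∈ words β l n, (a : ℝ) + frac β u ≤ e + frac β x →
            (e : ℝ) + frac β x ≤ b + frac β v → e :: x = a :: u ∨ e :: x = b :: v := by
          intro e x hx h1 h2
          have hbt : valueBtw (frac β) (a :: u) (e :: x) (b :: v) := by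
            rw [valueBtw, frac_cons_mem_uIcc_iff h]
            exact Set.mem_uIcc.2 (Or.inl ⟨h1, h2⟩)
          exact hb _ ⟨by simp [hx.1], mem_Ico_of_mem_uIcc hu.2.1 hv.2.1 hbt, hx.2⟩ hbt
        have hM1 : u = maxPrefix β l n := by
          rcases key a _ hM (by linarith [hmax u hu'])
            (add_lt_add_of_digit_lt (hM.2.frac_mem h) hvm hlt).le with h1 | h1
          · simpa using h1.symm
          · simp only [List.cons.injEq] at h1; omega
        have hm1 : v = minPrefix β l n := by
          rcases key b _ hm (add_lt_add_of_digit_lt hum (hm.2.frac_mem h) hlt).le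
            (by linarith [hmin v hv']) with h1 | h1
          · simp only [List.cons.injEq] at h1; omega
          · simpa using h1.symm
        -- otherwise `(a+1)0⋯0` would lie strictly between the two words
        have hba : b = a + 1 := by
          by_contra hne
          have hz := zeros_mem_words h n
          rcases key (a + 1) _ hz
            (add_lt_add_of_digit_lt hum (hz.2.frac_mem h) (by omega)).le
            (add_lt_add_of_digit_lt (hz.2.frac_mem h) hvm (by omega)).le with h1 | h1 <;>
          · simp only [List.cons.injEq] at h1; omega
        refine ⟨[], b, n, Or.inl ⟨?_, ?_⟩⟩
        · rw [hba, hM1]; simp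
        · rw [hm1]; rfl

/-- The image of a gap of type `k`: the walk from `w(d-1)max(k)0` to `wd min(k)0` passes through
`w(d-1)max(k+1)` and then, by one step of type `k+1`, through `wd min(k+1)`. -/
theorem wordCode_gap (h : IsParam β l) (w : List ℤ) (d : ℤ) (k : ℕ)
    (hM : Adm β l (w ++ (d - 1) :: maxPrefix β l k))
    (hm : Adm β l (w ++ d :: minPrefix β l k)) :
    WordCode β l (w.length + (k + 2)) (w ++ (d - 1) :: (maxPrefix β l k ++ [0]))
      (w ++ d :: (minPrefix β l k ++ [0]))
      (wordR k (minPrefix β l k) (maxPrefix β l k) (minPrefix β l (k + 1))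
          (maxPrefix β l (k + 1)) ++ [k + 1] ++
        (wordS k (minPrefix β l k) (maxPrefix β l k) (minPrefix β l (k + 1))
          (maxPrefix β l (k + 1))).reverse) := by
  obtain ⟨m0, -⟩ := minPrefix_spec h k
  obtain ⟨M0, -⟩ := maxPrefix_spec h k
  obtain ⟨m1, hmin⟩ := minPrefix_spec h (k + 1)
  obtain ⟨M1, hmax⟩ := maxPrefix_spec h (k + 1)
  have m0' := append_zero_mem_words h m0
  have M0' := append_zero_mem_words h M0
  have hR := wordCode_codeWord h M0' M1
  have hS := (wordCode_codeWord h m0' m1).reverse m0'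
  have hM' : Adm β l (w ++ (d - 1) :: (maxPrefix β l k ++ [0])) := by
    simpa using (adm_append_zeros h _ 1).2 hM
  have hm' : Adm β l (w ++ d :: (minPrefix β l k ++ [0])) := by
    simpa using (adm_append_zeros h _ 1).2 hm
  have aM0 := hM'.of_append
  have am0 := hm'.of_append
  have hle1 := hmax _ M0'
  have hle2 := hmin _ m0'
  have hlt := add_lt_add_of_digit_lt (M1.2.frac_mem h) (m1.2.frac_mem h) (sub_one_lt d)
  -- the four words are in monotone order, and the outer two are admissible
  have b1 : valueBtw (frac β) ((d - 1) :: (maxPrefix β l k ++ [0]))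
      ((d - 1) :: maxPrefix β l (k + 1)) (d :: (minPrefix β l k ++ [0])) := by
    rw [valueBtw, frac_cons_mem_uIcc_iff h, Set.mem_uIcc]
    exact Or.inl ⟨by linarith, by linarith⟩
  have b2 : valueBtw (frac β) ((d - 1) :: (maxPrefix β l k ++ [0]))
      (d :: minPrefix β l (k + 1)) (d :: (minPrefix β l k ++ [0])) := by
    rw [valueBtw, frac_cons_mem_uIcc_iff h, Set.mem_uIcc]
    exact Or.inl ⟨by linarith, by linarith⟩
  have b3 : valueBtw (frac β) ((d - 1) :: (maxPrefix β l k ++ [0]))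
      ((d - 1) :: maxPrefix β l (k + 1)) (d :: minPrefix β l (k + 1)) := by
    rw [valueBtw, frac_cons_mem_uIcc_iff h, Set.mem_uIcc]
    exact Or.inl ⟨by linarith, by linarith⟩
  have aM1 : Adm β l ((d - 1) :: maxPrefix β l (k + 1)) :=
    ⟨mem_Ico_of_mem_uIcc aM0.1 am0.1 b1, M1.2⟩
  have am1 : Adm β l (d :: minPrefix β l (k + 1)) := ⟨mem_Ico_of_mem_uIcc aM0.1 am0.1 b2, m1.2⟩
  have hstep : WordCode β l (k + 2) ((d - 1) :: maxPrefix β l (k + 1))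
      (d :: minPrefix β l (k + 1)) [k + 1] := by
    have hd : diffPos ((d - 1) :: maxPrefix β l (k + 1)) (d :: minPrefix β l (k + 1)) = k + 1 := by
      rw [diffPos_cons_of_ne (by omega), M1.1]
    have := Code.cons (B := valueBtw (frac β)) (X := words β l (k + 2)) (c := diffPos)
      (s := (d - 1) :: maxPrefix β l (k + 1)) (s₁ := d :: minPrefix β l (k + 1))
      ⟨by simp [m1.1], am1⟩
      (fun he => by simp only [List.cons.injEq] at he; omega) Set.right_mem_uIcc
      (fun x hx hb => eq_or_eq_of_valueBtw_extremal h (k + 1) d hx hb) (.nil _)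
    rwa [hd] at this
  have hcode := Code.append (Code.append (hR.cons h (d - 1) M0' M1 aM0 aM1) hstep b3)
    (hS.cons h d m1 m0' am1 am0) b2
  exact WordCode.append_left h w hcode ⟨by simp [M0'.1], aM0⟩ ⟨by simp [m0'.1], am0⟩ hM' hm'

end

/-! ### The set of integers -/

/-- The words `u` of length `n` for which `u0^ω` is strongly admissible. -/
def strongWords (β l : ℝ) (n : ℕ) : Set (List ℤ) := {u | u.length = n ∧ Adm β l (0 :: u)}

section

variable {β l : ℝ} {n : ℕ} {u v : List ℤ}

theorem strongWords_subset_words : strongWords β l n ⊆ words β l n := fun _ hu => ⟨hu.1, hu.2.2⟩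

theorem gamma_zero_cons (β : ℝ) (u : List ℤ) : gamma β (0 :: u) = gamma β u := by simp [gamma]

theorem gamma_zeros_append (β : ℝ) (j : ℕ) (u : List ℤ) :
    gamma β (List.replicate j 0 ++ u) = gamma β u := by
  induction j with
  | zero => rfl
  | succ j ih => rw [List.replicate_succ, List.cons_append, gamma_zero_cons, ih]

theorem frac_zero_cons (β : ℝ) (u : List ℤ) : frac β (0 :: u) = frac β u / (-β) := by
  simp [frac]

theorem adm_zero_cons_of_lt (h : IsParam β l) (hu : Adm β l u) (hl : l < frac β u) :
    Adm β l (0 :: u) :=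
  ⟨by rw [frac_zero_cons]; exact h.div_mem (hu.frac_mem h) hl, hu⟩

theorem zero_cons_mem_strongWords (h : IsParam β l) (hu : u ∈ strongWords β l n) :
    0 :: u ∈ strongWords β l (n + 1) := by
  refine ⟨by simp [hu.1], adm_zero_cons_of_lt h hu.2 ?_⟩
  rw [frac_zero_cons]
  exact h.lt_div (hu.2.2.frac_mem h)

theorem zeros_append_mem_strongWords (h : IsParam β l) (j : ℕ) (hu : u ∈ strongWords β l n) :
    List.replicate j 0 ++ u ∈ strongWords β l (n + j) := by
  induction j with
  | zero => exact hu
  | succ j ih => exact zero_cons_mem_strongWords h ih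

theorem append_zero_mem_strongWords (h : IsParam β l) (hu : u ∈ strongWords β l n) :
    u ++ [0] ∈ strongWords β l (n + 1) :=
  ⟨by simp [hu.1], (adm_append_zeros h (0 :: u) 1).2 hu.2⟩

/-- Every `(-β)`-integer has a strongly admissible representation. An admissible word `u` fails to
be strongly admissible only if its value is `l = -β/(β+1)`, and then `1u0` represents the same
number. -/
theorem mem_integers_iff (h : IsParam β l) (x : ℝ) :
    x ∈ integers β l ↔ ∃ n, ∃ u ∈ strongWords β l n, gamma β u = x := by
  constructor
  · rintro ⟨u, hu, rfl⟩
    rw [admissible_iff h] at hu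
    by_cases hs : Adm β l (0 :: u)
    · exact ⟨_, u, ⟨rfl, hs⟩, rfl⟩
    have hb := h.pos
    have hl : frac β u = l := by
      by_contra hne
      exact hs (adm_zero_cons_of_lt h hu (lt_of_le_of_ne (hu.frac_mem h).1 (Ne.symm hne)))
    have hlb : l * (β + 1) = -β := by
      refine le_antisymm ?_ h.neg_beta_le
      by_contra! hlt
      refine hs ⟨?_, hu⟩
      rw [frac_zero_cons, hl]
      have h1 := h.le_neg_one
      rw [Set.mem_Ico, le_div_iff_of_neg (by linarith), div_lt_iff_of_neg (by linarith)]
      constructor <;> nlinarith [h.left_neg]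
    have h1 : -β * frac β (1 :: u) = 1 + l := by
      rw [frac_cons h, hl]
      simp
    have h2 : l < frac β (1 :: u) := by nlinarith [h.one_lt]
    have h3 : frac β (1 :: u) < 0 := by nlinarith [h.right_pos]
    have h4 : Adm β l (1 :: u) := ⟨⟨h2.le, by linarith [h.right_pos]⟩, hu⟩
    refine ⟨_, _, append_zero_mem_strongWords h ⟨rfl, adm_zero_cons_of_lt h h4 h2⟩, ?_⟩
    rw [gamma_append_singleton_zero, gamma_eq h, gamma_eq h, List.length_cons, pow_succ, mul_assoc,
      h1, hl]
    have h5 : -β * (1 + l) = l := by linarith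
    calc -β * ((-β) ^ u.length * (1 + l)) = (-β) ^ u.length * (-β * (1 + l)) := by ring
      _ = _ := by rw [h5]
  · rintro ⟨n, u, hu, rfl⟩
    exact ⟨u, (admissible_iff h u).2 hu.2.2, rfl⟩

theorem gamma_mem_integers (h : IsParam β l) (hu : u ∈ strongWords β l n) :
    gamma β u ∈ integers β l := (mem_integers_iff h _).2 ⟨n, u, hu, rfl⟩

theorem neg_beta_mul_mem_integers (h : IsParam β l) {x : ℝ} (hx : x ∈ integers β l) :
    -β * x ∈ integers β l := by
  obtain ⟨n, u, hu, rfl⟩ := (mem_integers_iff h x).1 hx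
  rw [← gamma_append_singleton_zero]
  exact gamma_mem_integers h (append_zero_mem_strongWords h hu)

theorem zero_mem_integers (h : IsParam β l) : (0 : ℝ) ∈ integers β l :=
  ⟨[], (admissible_iff h _).2 trivial, rfl⟩

theorem gamma_injOn_strongWords (h : IsParam β l) (n : ℕ) :
    Set.InjOn (gamma β) (strongWords β l n) := by
  intro u hu v hv huv
  rw [gamma_eq h, gamma_eq h, hu.1, hv.1] at huv
  exact frac_injOn_words h n (strongWords_subset_words hu) (strongWords_subset_words hv)
    (mul_left_cancel₀ (pow_ne_zero _ (by linarith [h.pos])) huv)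

theorem mul_mem_uIcc_iff {c a b x : ℝ} (hc : c ≠ 0) :
    c * x ∈ Set.uIcc (c * a) (c * b) ↔ x ∈ Set.uIcc a b := by
  have := Set.preimage_const_mul_uIcc hc (c * a) (c * b)
  rw [mul_div_cancel_left₀ _ hc, mul_div_cancel_left₀ _ hc] at this
  rw [← this, Set.mem_preimage]

theorem gamma_mem_uIcc_iff (h : IsParam β l) {u x v : List ℤ} (hu : u.length = n)
    (hx : x.length = n) (hv : v.length = n) :
    gamma β x ∈ Set.uIcc (gamma β u) (gamma β v) ↔ valueBtw (frac β) u x v := by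
  rw [gamma_eq h, gamma_eq h, gamma_eq h, hu, hx, hv,
    mul_mem_uIcc_iff (pow_ne_zero _ (by linarith [h.pos])), valueBtw]

theorem mem_strongWords_of_valueBtw (h : IsParam β l) {x : List ℤ} (hu : u ∈ strongWords β l n)
    (hv : v ∈ strongWords β l n) (hx : x ∈ words β l n) (hb : valueBtw (frac β) u x v) :
    x ∈ strongWords β l n :=
  ⟨hx.1, adm_append_of_mem_uIcc h (w := [0]) hu.2 hv.2 hx.2 hb⟩

/-- A `(-β)`-integer `x` such that `x(-β)^{-n}` and `x(-β)^{-n-1}` are in `[l, l+1)` has a strongly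
admissible representation of length `n`: the leading digits of a longer one vanish. -/
theorem exists_strongWords_of_div_mem (h : IsParam β l) {x : ℝ} (hx : x ∈ integers β l)
    (h0 : x / (-β) ^ n ∈ Set.Ico l (l + 1)) (h1 : x / (-β) ^ (n + 1) ∈ Set.Ico l (l + 1)) :
    ∃ u ∈ strongWords β l n, gamma β u = x := by
  have hne : -β ≠ 0 := by linarith [h.pos]
  have hmem : ∀ m, n ≤ m → x / (-β) ^ m ∈ Set.Ico l (l + 1) ∧
      x / (-β) ^ (m + 1) ∈ Set.Ico l (l + 1) := by
    intro m hm
    induction m, hm using Nat.le_induction with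
    | base => exact ⟨h0, h1⟩
    | succ m hm ih =>
      refine ⟨ih.2, ?_⟩
      have hl := h.lt_div ih.1
      rw [div_div, ← pow_succ] at hl
      have := h.div_mem ih.2 hl
      rwa [div_div, ← pow_succ] at this
  obtain ⟨j, u, hu, rfl⟩ := (mem_integers_iff h x).1 hx
  clear hx h0 h1
  by_cases hjn : j ≤ n
  · refine ⟨_, ?_, gamma_zeros_append β (n - j) u⟩
    have := zeros_append_mem_strongWords h (n - j) hu
    rwa [Nat.add_sub_cancel' hjn] at this
  induction u generalizing j with
  | nil => exact absurd hu.1 (by simp; omega)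
  | cons a t ih =>
    have hlen : t.length + 1 = j := by simpa using hu.1
    have ht := hu.2.2.2
    have h2 := (hmem t.length (by omega)).1
    rw [gamma_eq h, List.length_cons, pow_succ, mul_assoc,
      mul_div_cancel_left₀ _ (pow_ne_zero _ hne), frac_cons h] at h2
    have ha : a = 0 := digit_eq_of_add_eq (b := 0) (ht.frac_mem h) h2 (by simp)
    subst ha
    rw [gamma_zero_cons] at hmem ⊢
    have ht' : t ∈ strongWords β l t.length := ⟨rfl, hu.2.2⟩
    by_cases htn : t.length ≤ n
    · have : t.length = n := by omega
      exact ⟨t, this ▸ ht', rfl⟩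
    · apply ih t.length <;> assumption

theorem exists_strongWords_of_mem_uIcc (h : IsParam β l) {x : ℝ} (hx : x ∈ integers β l)
    (hu : u ∈ strongWords β l n) (hv : v ∈ strongWords β l n)
    (hb : x ∈ Set.uIcc (gamma β u) (gamma β v)) :
    ∃ y ∈ strongWords β l n, gamma β y = x := by
  have hne : -β ≠ 0 := by linarith [h.pos]
  have hb' : x / (-β) ^ n ∈ Set.uIcc (frac β u) (frac β v) := by
    rwa [← mul_mem_uIcc_iff (pow_ne_zero n hne), mul_div_cancel₀ _ (pow_ne_zero n hne),
      ← hu.1, ← gamma_eq h, hu.1, ← hv.1, ← gamma_eq h]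
  have hb'' : x / (-β) ^ (n + 1) ∈ Set.uIcc (frac β (0 :: u)) (frac β (0 :: v)) := by
    rwa [← mul_mem_uIcc_iff hne, frac_cons h, frac_cons h, Int.cast_zero, zero_add, zero_add,
      pow_succ, ← div_div, mul_div_cancel₀ _ hne]
  exact exists_strongWords_of_div_mem h hx
    (mem_Ico_of_mem_uIcc (hu.2.2.frac_mem h) (hv.2.2.frac_mem h) hb')
    (mem_Ico_of_mem_uIcc hu.2.1 hv.2.1 hb'')

/-- Two `(-β)`-integers have strongly admissible representations of the same length. -/
theorem exists_strongWords_pair (h : IsParam β l) {x y : ℝ} (hx : x ∈ integers β l)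
    (hy : y ∈ integers β l) : ∃ n, ∃ u ∈ strongWords β l n, ∃ v ∈ strongWords β l n,
      gamma β u = x ∧ gamma β v = y := by
  obtain ⟨n, u, hu, rfl⟩ := (mem_integers_iff h x).1 hx
  obtain ⟨m, v, hv, rfl⟩ := (mem_integers_iff h y).1 hy
  refine ⟨n + m, _, zeros_append_mem_strongWords h m hu, List.replicate n 0 ++ v, ?_,
    gamma_zeros_append _ _ _, gamma_zeros_append _ _ _⟩
  rw [add_comm]
  exact zeros_append_mem_strongWords h n hv

theorem finite_integers_inter_Icc (h : IsParam β l) (a b : ℝ) :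
    (integers β l ∩ Set.Icc a b).Finite := by
  -- `[-c, c]` is inside `[l, l+1)`, and its `β^n`-multiple covers `[a, b]`
  set c := min (-l) (l + 1) / 2 with hc
  have hmin : 0 < min (-l) (l + 1) := lt_min (by linarith [h.left_neg]) h.right_pos
  have hcpos : 0 < c := by positivity
  have hc1 : c < -l := by linarith [min_le_left (-l) (l + 1)]
  have hc2 : c < l + 1 := by linarith [min_le_right (-l) (l + 1)]
  obtain ⟨n, hn⟩ := pow_unbounded_of_one_lt (max |a| |b| / c) h.one_lt
  rw [div_lt_iff₀ hcpos] at hn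
  refine (((finite_words h n).subset strongWords_subset_words).image (gamma β)).subset ?_
  rintro x ⟨hx, hxa, hxb⟩
  have habs : |x| ≤ c * β ^ n := by
    have : |x| ≤ max |a| |b| := abs_le_max_abs_abs hxa hxb
    linarith
  have key : ∀ m, n ≤ m → x / (-β) ^ m ∈ Set.Ico l (l + 1) := by
    intro m hm
    have hpm : 0 < β ^ m := pow_pos h.pos m
    have h1 : |x / (-β) ^ m| ≤ c := by
      rw [abs_div, abs_pow, abs_neg, abs_of_pos h.pos, div_le_iff₀ hpm]
      exact habs.trans (mul_le_mul_of_nonneg_left (pow_le_pow_right₀ h.one_lt.le hm) hcpos.le)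
    have h2 := abs_le.1 h1
    exact ⟨by linarith [h2.1], by linarith [h2.2]⟩
  obtain ⟨u, hu, hux⟩ := exists_strongWords_of_div_mem h hx (key n le_rfl) (key _ n.le_succ)
  exact ⟨u, hu, hux⟩

/-- Multiplication by `-β` shows that the `(-β)`-integers are unbounded in both directions. -/
theorem exists_integers_gt_lt (h : IsParam β l) (hne : integers β l ≠ {0}) (B : ℝ) :
    (∃ y ∈ integers β l, B < y) ∧ ∃ y ∈ integers β l, y < B := by
  obtain ⟨y, hy, hy0⟩ : ∃ y ∈ integers β l, y ≠ 0 := by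
    by_contra! hcon
    exact hne (Set.eq_singleton_iff_unique_mem.2 ⟨zero_mem_integers h, hcon⟩)
  obtain ⟨p, hp, hppos⟩ : ∃ p ∈ integers β l, 0 < p := by
    rcases lt_or_gt_of_ne hy0 with hlt | hgt
    · exact ⟨_, neg_beta_mul_mem_integers h hy, by nlinarith [h.pos]⟩
    · exact ⟨y, hy, hgt⟩
  have hpow : ∀ m : ℕ, β ^ (2 * m) * p ∈ integers β l := by
    intro m
    induction m with
    | zero => simpa using hp
    | succ m ih =>
      have h1 := neg_beta_mul_mem_integers h (neg_beta_mul_mem_integers h ih)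
      convert h1 using 1
      ring
  obtain ⟨m, hm⟩ := pow_unbounded_of_one_lt (|B| / p) h.one_lt
  rw [div_lt_iff₀ hppos] at hm
  have h1 : |B| < β ^ (2 * m) * p :=
    hm.trans_le (mul_le_mul_of_nonneg_right
      (pow_le_pow_right₀ h.one_lt.le (by omega)) hppos.le)
  refine ⟨⟨_, hpow m, (le_abs_self B).trans_lt h1⟩,
    ⟨_, neg_beta_mul_mem_integers h (hpow m), ?_⟩⟩
  nlinarith [neg_abs_le B, h.one_lt, abs_nonneg B]

/-! ### Gaps between consecutive integers -/

/-- The type of a gap is the position of the leftmost digit that changes, in any strongly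
admissible representation of the two end points. -/
theorem diffPos_eq_of_isGapOfType (h : IsParam β l) {k : ℕ} {x y : ℝ}
    (hg : IsGapOfType β l k x y) (hu : u ∈ strongWords β l n) (hv : v ∈ strongWords β l n)
    (hux : gamma β u = x) (hvy : gamma β v = y) : diffPos u v = k := by
  obtain ⟨w, d, hM, hm, heven, hodd⟩ := hg
  rw [stronglyAdmissible_iff h] at hM hm
  obtain ⟨m0, -⟩ := minPrefix_spec h k
  obtain ⟨M0, -⟩ := maxPrefix_spec h k
  have key : ∀ {U V : List ℤ}, U.length = V.length → Adm β l (0 :: U) → Adm β l (0 :: V) →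
      gamma β U = x → gamma β V = y → diffPos u v = diffPos U V := by
    intro U V hl hU hV hUx hVy
    have hU' : U ∈ strongWords β l U.length := ⟨rfl, hU⟩
    have hV' : V ∈ strongWords β l U.length := ⟨hl.symm, hV⟩
    have e1 := gamma_injOn_strongWords h _ (zeros_append_mem_strongWords h U.length hu)
      (add_comm n U.length ▸ zeros_append_mem_strongWords h n hU')
      (by rw [gamma_zeros_append, gamma_zeros_append, hux, hUx])
    have e2 := gamma_injOn_strongWords h _ (zeros_append_mem_strongWords h U.length hv)
      (add_comm n U.length ▸ zeros_append_mem_strongWords h n hV')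
      (by rw [gamma_zeros_append, gamma_zeros_append, hvy, hVy])
    rw [← diffPos_append (List.replicate U.length 0), e1, e2, diffPos_append]
  rcases Nat.even_or_odd k with hk | hk
  · obtain ⟨h1, h2⟩ := heven hk
    rw [key (by simp [m0.1, M0.1]) hM hm h1.symm h2.symm, diffPos_append,
      diffPos_cons_of_ne (by omega), M0.1]
  · obtain ⟨h1, h2⟩ := hodd hk
    rw [key (by simp [m0.1, M0.1]) hm hM h1.symm h2.symm, diffPos_append,
      diffPos_cons_of_ne (by omega), m0.1]

theorem gamma_append_sub (β : ℝ) (w : List ℤ) (hl : u.length = v.length) :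
    gamma β (w ++ u) - gamma β (w ++ v) = gamma β u - gamma β v := by
  induction w with
  | nil => rfl
  | cons a w ih =>
    rw [List.cons_append, List.cons_append, gamma, gamma, List.length_append, List.length_append,
      hl]
    linarith

theorem gamma_gap_sub (h : IsParam β l) (w : List ℤ) (d : ℤ) (k : ℕ) :
    gamma β (w ++ d :: minPrefix β l k) - gamma β (w ++ (d - 1) :: maxPrefix β l k) =
      (-β) ^ k + gamma β (minPrefix β l k) - gamma β (maxPrefix β l k) := by
  obtain ⟨m0, -⟩ := minPrefix_spec h k
  obtain ⟨M0, -⟩ := maxPrefix_spec h k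
  rw [gamma_append_sub β w (by simp [m0.1, M0.1]), gamma, gamma, m0.1, M0.1]
  push_cast
  ring

/-- The quantity `(-β)^k + γ(min(k)) - γ(max(k))` has the sign of `(-1)^k`. -/
theorem gamma_gap_pos (h : IsParam β l) (k : ℕ) :
    0 < (-1) ^ k * ((-β) ^ k + gamma β (minPrefix β l k) - gamma β (maxPrefix β l k)) := by
  obtain ⟨m0, -⟩ := minPrefix_spec h k
  obtain ⟨M0, -⟩ := maxPrefix_spec h k
  have h1 : 0 < 1 + frac β (minPrefix β l k) - frac β (maxPrefix β l k) := by
    linarith [(m0.2.frac_mem h).1, (M0.2.frac_mem h).2]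
  have h2 : (-1) ^ k * ((-β) ^ k + gamma β (minPrefix β l k) - gamma β (maxPrefix β l k)) =
      β ^ k * (1 + frac β (minPrefix β l k) - frac β (maxPrefix β l k)) := by
    rw [gamma_eq h, gamma_eq h, m0.1, M0.1, ← mul_neg_one β, mul_pow]
    have : ((-1 : ℝ) ^ k) * (-1) ^ k = 1 := by rw [← mul_pow]; simp
    linear_combination
      (β ^ k * (1 + frac β (minPrefix β l k) - frac β (maxPrefix β l k))) * this
  rw [h2]
  exact mul_pos (pow_pos h.pos k) h1

theorem exists_isGapOfType (h : IsParam β l) {x y : ℝ} (hx : x ∈ integers β l)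
    (hy : y ∈ integers β l) (hxy : x < y) (hb : ∀ t ∈ integers β l, ¬ (x < t ∧ t < y)) :
    ∃ k, IsGapOfType β l k x y := by
  obtain ⟨n, u, hu, v, hv, rfl, rfl⟩ := exists_strongWords_pair h hx hy
  obtain ⟨w, d, k, hw⟩ := exists_extremal_of_neighbours h (strongWords_subset_words hu)
    (strongWords_subset_words hv) (fun he => hxy.ne (by rw [he])) (fun t ht htb => by
      have hts := mem_strongWords_of_valueBtw h hu hv ht htb
      have hg := (gamma_mem_uIcc_iff h hu.1 ht.1 hv.1).2 htb
      rw [Set.uIcc_of_le hxy.le] at hg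
      have h1 := hb _ (gamma_mem_integers h hts)
      rcases hg.1.eq_or_lt with he | hlt
      · exact Or.inl (gamma_injOn_strongWords h n hts hu he.symm)
      · refine Or.inr (gamma_injOn_strongWords h n hts hv (le_antisymm hg.2 ?_))
        by_contra! hc
        exact h1 ⟨hlt, hc⟩)
  have hsub := gamma_gap_sub h w d k
  have hpos := gamma_gap_pos h k
  rcases hw with ⟨hu', hv'⟩ | ⟨hv', hu'⟩
  · rw [hu', hv'] at hxy
    refine ⟨k, w, d, ?_, ?_, fun _ => ⟨by rw [hu'], by rw [hv']⟩, fun hk => ?_⟩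
    · rw [stronglyAdmissible_iff h, ← hu']; exact hu.2
    · rw [stronglyAdmissible_iff h, ← hv']; exact hv.2
    · rw [hk.neg_one_pow, ← hsub] at hpos
      linarith
  · rw [hu', hv'] at hxy
    refine ⟨k, w, d, ?_, ?_, fun hk => ?_, fun _ => ⟨by rw [hu'], by rw [hv']⟩⟩
    · rw [stronglyAdmissible_iff h, ← hv']; exact hv.2
    · rw [stronglyAdmissible_iff h, ← hu']; exact hu.2
    · rw [hk.neg_one_pow, ← hsub] at hpos
      linarith

theorem sub_eq_gapLength (h : IsParam β l) {k : ℕ} {x y : ℝ} (hg : IsGapOfType β l k x y) :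
    y - x = gapLength β l k := by
  obtain ⟨w, d, -, -, heven, hodd⟩ := hg
  have hsub := gamma_gap_sub h w d k
  have hpos := gamma_gap_pos h k
  rw [gapLength]
  rcases Nat.even_or_odd k with hk | hk
  · obtain ⟨rfl, rfl⟩ := heven hk
    rw [hk.neg_one_pow, one_mul] at hpos
    rw [hsub, abs_of_pos hpos]
  · obtain ⟨rfl, rfl⟩ := hodd hk
    rw [hk.neg_one_pow] at hpos
    rw [abs_of_neg (by linarith), ← hsub]
    ring

end

/-! ### Enumeration of locally finite sets -/

section Enumeration

variable {Z : Set ℝ}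

/-- A locally finite set of real numbers that is unbounded in both directions is enumerated
increasingly by the integers. -/
theorem exists_enumeration (h0 : (0 : ℝ) ∈ Z) (hfin : ∀ a b, (Z ∩ Set.Icc a b).Finite)
    (hup : ∀ B, ∃ y ∈ Z, B < y) (hdown : ∀ B, ∃ y ∈ Z, y < B) :
    ∃ z : ℤ → ℝ, StrictMono z ∧ z 0 = 0 ∧ Set.range z = Z := by
  classical
  let : LocallyFiniteOrder Z := LocallyFiniteOrder.ofFiniteIcc fun a b => by
    refine Set.Finite.of_finite_image (f := Subtype.val) ((hfin a b).subset ?_)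
      Subtype.val_injective.injOn
    rintro _ ⟨x, hx, rfl⟩
    exact ⟨x.2, hx.1, hx.2⟩
  let : SuccOrder Z := LinearLocallyFiniteOrder.succOrder Z
  let : PredOrder Z := LinearLocallyFiniteOrder.predOrder Z
  have : NoMaxOrder Z := ⟨fun a => by
    obtain ⟨y, hy, hay⟩ := hup a
    exact ⟨⟨y, hy⟩, hay⟩⟩
  have : NoMinOrder Z := ⟨fun a => by
    obtain ⟨y, hy, hay⟩ := hdown a
    exact ⟨⟨y, hy⟩, hay⟩⟩
  have : Nonempty Z := ⟨⟨0, h0⟩⟩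
  let e : Z ≃o ℤ := orderIsoIntOfLinearSuccPredArch
  refine ⟨fun n => e.symm (n + e ⟨0, h0⟩), fun a b hab => ?_, by simp, ?_⟩
  · exact e.symm.strictMono (by simpa using hab)
  · ext x
    constructor
    · rintro ⟨n, rfl⟩
      exact Subtype.property _
    · intro hx
      exact ⟨e ⟨x, hx⟩ - e ⟨0, h0⟩, by simp⟩

theorem no_mem_between {z : ℤ → ℝ} (hz : StrictMono z) (hr : Set.range z = Z) (n : ℤ) {t : ℝ}
    (ht : t ∈ Z) : ¬ (z n < t ∧ t < z (n + 1)) := by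
  rw [← hr] at ht
  obtain ⟨m, rfl⟩ := ht
  rw [hz.lt_iff_lt, hz.lt_iff_lt]
  omega

theorem enumeration_unique {z z' : ℤ → ℝ} (hz : StrictMono z) (hz0 : z 0 = 0)
    (hr : Set.range z = Z) (hz' : StrictMono z') (hz0' : z' 0 = 0) (hr' : Set.range z' = Z) :
    z' = z := by
  -- the successor of a point of `Z` is determined, and so is its predecessor
  have hsucc : ∀ n, z' n = z n → z' (n + 1) = z (n + 1) := by
    intro n hn
    have h1 := no_mem_between hz hr n (hr' ▸ Set.mem_range_self (n + 1))
    have h2 := no_mem_between hz' hr' n (hr ▸ Set.mem_range_self (n + 1))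
    have h3 := hz (lt_add_one n)
    have h4 := hz' (lt_add_one n)
    refine le_antisymm (not_lt.1 fun hc => h2 ⟨hn ▸ h3, hc⟩) (not_lt.1 fun hc => h1 ⟨hn ▸ h4, hc⟩)
  have hpred : ∀ n, z' (n + 1) = z (n + 1) → z' n = z n := by
    intro n hn
    have h1 := no_mem_between hz hr n (hr' ▸ Set.mem_range_self n)
    have h2 := no_mem_between hz' hr' n (hr ▸ Set.mem_range_self n)
    have h3 := hz (lt_add_one n)
    have h4 := hz' (lt_add_one n)
    refine le_antisymm (not_lt.1 fun hc => h1 ⟨hc, hn ▸ h4⟩) (not_lt.1 fun hc => h2 ⟨hc, hn ▸ h3⟩)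
  funext n
  induction n using Int.induction_on with
  | zero => rw [hz0, hz0']
  | succ n ih => exact hsucc _ ih
  | pred n ih => exact hpred _ (by rwa [sub_add_cancel])

end Enumeration

/-! ### Factors of bi-infinite words -/

section Factor

theorem factor_length (v : ℤ → ℕ) (i : ℤ) (n : ℕ) : (factor v i n).length = n := by
  simp [factor]

theorem factor_succ (v : ℤ → ℕ) (i : ℤ) (n : ℕ) :
    factor v i (n + 1) = v i :: factor v (i + 1) n := by
  rw [factor, factor, List.range_succ_eq_map, List.map_cons, List.map_map]
  simp only [Nat.cast_zero, add_zero, List.cons.injEq, true_and]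
  refine List.map_congr_left fun j _ => ?_
  simp only [Function.comp_apply]
  congr 1
  push_cast
  ring

theorem factor_add (v : ℤ → ℕ) (i : ℤ) (m n : ℕ) :
    factor v i (m + n) = factor v i m ++ factor v (i + m) n := by
  induction m generalizing i with
  | zero => simp [factor]
  | succ m ih =>
    rw [Nat.add_right_comm, factor_succ, ih, factor_succ, List.cons_append]
    congr 3
    push_cast
    ring

theorem factor_one (v : ℤ → ℕ) (i : ℤ) : factor v i 1 = [v i] := by simp [factor]

end Factor

/-! ### The antimorphism -/

section Main

variable {β l : ℝ} {z : ℤ → ℝ} {v : ℤ → ℕ}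

/-- In admissible words of any sufficient length, the walk from `z_a` to `z_{a+m}` reads the factor
`v_a⋯v_{a+m-1}`. For odd lengths the values of the words decrease along the walk. -/
theorem wordCode_factor (h : IsParam β l) (hz : IsEnumeration β l z) (hv : IsCoding β l z v)
    {n : ℕ} {s t : List ℤ} (hs : s ∈ strongWords β l n) (ht : t ∈ strongWords β l n) {a : ℤ}
    {m : ℕ} (hsa : gamma β s = z a) (htm : gamma β t = z (a + m)) :
    WordCode β l n s t (factor v a m) := by
  obtain ⟨hmono, -, hr⟩ := hz
  induction m generalizing s a with
  | zero =>
    obtain rfl := gamma_injOn_strongWords h n hs ht (by rw [hsa, htm]; simp)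
    exact Code.nil _
  | succ m ih =>
    have hle : z (a + 1) ≤ z (a + (m + 1 : ℕ)) := hmono.monotone (by push_cast; omega)
    have hlt := hmono (lt_add_one a)
    have hmem : z (a + 1) ∈ Set.uIcc (gamma β s) (gamma β t) := by
      rw [hsa, htm]
      exact Set.mem_uIcc.2 (Or.inl ⟨hlt.le, hle⟩)
    obtain ⟨s₁, hs₁, hg⟩ := exists_strongWords_of_mem_uIcc h
      (hr ▸ Set.mem_range_self (a + 1)) hs ht hmem
    rw [factor_succ, ← diffPos_eq_of_isGapOfType h (hv a) hs hs₁ hsa hg]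
    refine Code.cons (strongWords_subset_words hs₁) (fun he => hlt.ne ?_) ?_ (fun x hx hb => ?_)
      (ih hs₁ hg (by rw [htm]; push_cast; congr 1; ring))
    · rw [← hsa, ← hg, he]
    · rwa [← gamma_mem_uIcc_iff h hs.1 hs₁.1 ht.1, hg]
    · have hxs := mem_strongWords_of_valueBtw h hs hs₁ hx hb
      have hxg := (gamma_mem_uIcc_iff h hs.1 hx.1 hs₁.1).2 hb
      rw [hsa, hg, Set.uIcc_of_le hlt.le] at hxg
      have hno := no_mem_between hmono hr a (gamma_mem_integers h hxs)
      rcases hxg.1.eq_or_lt with he | hlt'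
      · exact Or.inl (gamma_injOn_strongWords h n hxs hs (by rw [hsa, ← he]))
      · refine Or.inr (gamma_injOn_strongWords h n hxs hs₁ (le_antisymm (hxg.2.trans hg.ge) ?_))
        rw [hg]
        exact not_lt.1 fun hc => hno ⟨hlt', hc⟩

/-- The antimorphism on letters. The image of `k` reads the gaps from left to right between the
`-β`-multiples of the end points of a gap of type `k`; for even `k` the walk of `wordCode_gap` runs
through them from right to left. -/
noncomputable def letterImage (β l : ℝ) (k : ℕ) : List ℕ :=
  if Even k then
    wordS k (minPrefix β l k) (maxPrefix β l k) (minPrefix β l (k + 1)) (maxPrefix β l (k + 1)) ++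
      [k + 1] ++
      (wordR k (minPrefix β l k) (maxPrefix β l k) (minPrefix β l (k + 1))
        (maxPrefix β l (k + 1))).reverse
  else
    wordR k (minPrefix β l k) (maxPrefix β l k) (minPrefix β l (k + 1)) (maxPrefix β l (k + 1)) ++
      [k + 1] ++
      (wordS k (minPrefix β l k) (maxPrefix β l k) (minPrefix β l (k + 1))
        (maxPrefix β l (k + 1))).reverse

theorem succ_mem_letterImage (β l : ℝ) (k : ℕ) : k + 1 ∈ letterImage β l k := by
  rw [letterImage]
  split_ifs <;> simp

/-- The antimorphism of `ℕ*` extending `letterImage`. -/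
noncomputable def gapAntimorphism (β l : ℝ) (u : List ℕ) : List ℕ :=
  u.reverse.flatMap (letterImage β l)

theorem gapAntimorphism_append (u w : List ℕ) :
    gapAntimorphism β l (u ++ w) = gapAntimorphism β l w ++ gapAntimorphism β l u := by
  simp [gapAntimorphism]

theorem gapAntimorphism_singleton (k : ℕ) : gapAntimorphism β l [k] = letterImage β l k := by
  simp [gapAntimorphism]

theorem mem_gapAntimorphism {u : List ℕ} {k : ℕ} (hk : k ∈ u) :
    k + 1 ∈ gapAntimorphism β l u := by
  rw [gapAntimorphism, List.mem_flatMap]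
  exact ⟨k, List.mem_reverse.2 hk, succ_mem_letterImage β l k⟩

/-- Multiplication by `-β` maps the gap `[z_n, z_{n+1}]` onto an interval whose gaps are coded by
the image of the letter `v_n`. -/
theorem letterImage_eq_factor (h : IsParam β l) (hz : IsEnumeration β l z)
    (hv : IsCoding β l z v) (n : ℤ) :
    ∃ (a : ℤ) (m : ℕ), z a = -β * z (n + 1) ∧ z (a + m) = -β * z n ∧
      letterImage β l (v n) = factor v a m := by
  obtain ⟨hmono, -, hr⟩ := id hz
  have hmem : ∀ i, z i ∈ integers β l := fun i => hr ▸ Set.mem_range_self i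
  obtain ⟨a, ha⟩ : -β * z (n + 1) ∈ Set.range z := hr ▸ neg_beta_mul_mem_integers h (hmem _)
  obtain ⟨b, hb⟩ : -β * z n ∈ Set.range z := hr ▸ neg_beta_mul_mem_integers h (hmem _)
  have hab : a ≤ b := by
    rw [← hmono.le_iff_le, ha, hb]
    nlinarith [hmono (lt_add_one n), h.pos]
  obtain ⟨m, rfl⟩ : ∃ m : ℕ, b = a + m := ⟨(b - a).toNat, by omega⟩
  refine ⟨a, m, ha, hb, ?_⟩
  obtain ⟨w, d, hM, hm, heven, hodd⟩ := hv n
  rw [stronglyAdmissible_iff h] at hM hm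
  set k := v n with hk
  obtain ⟨m0, -⟩ := minPrefix_spec h k
  obtain ⟨M0, -⟩ := maxPrefix_spec h k
  have hcode := wordCode_gap h w d k hM.2 hm.2
  have hMs := append_zero_mem_strongWords h (⟨rfl, hM⟩ : _ ∈ strongWords β l _)
  have hms := append_zero_mem_strongWords h (⟨rfl, hm⟩ : _ ∈ strongWords β l _)
  have hMl : (w ++ (d - 1) :: maxPrefix β l k).length + 1 = w.length + (k + 2) := by
    simp [M0.1]; omega
  have hml : (w ++ d :: minPrefix β l k).length + 1 = w.length + (k + 2) := by
    simp [m0.1]; omega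
  have hMg := gamma_append_singleton_zero β (w ++ (d - 1) :: maxPrefix β l k)
  have hmg := gamma_append_singleton_zero β (w ++ d :: minPrefix β l k)
  rw [hMl] at hMs
  rw [hml] at hms
  simp only [List.append_assoc, List.cons_append] at hMs hms hMg hmg
  rw [letterImage]
  rcases Nat.even_or_odd k with hpar | hpar
  · rw [if_pos hpar]
    obtain ⟨h1, h2⟩ := heven hpar
    have hfac := wordCode_factor h hz hv hms hMs (a := a) (m := m)
      (by rw [hmg, ← h2, ha]) (by rw [hMg, ← h1, hb])
    have hrev := WordCode.reverse (strongWords_subset_words hMs) hcode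
    rw [← hrev.unique h (strongWords_subset_words hms) hfac]
    simp
  · rw [if_neg (Nat.not_even_iff_odd.2 hpar)]
    obtain ⟨h1, h2⟩ := hodd hpar
    have hfac := wordCode_factor h hz hv hMs hms (a := a) (m := m)
      (by rw [hMg, ← h2, ha]) (by rw [hmg, ← h1, hb])
    exact WordCode.unique h (strongWords_subset_words hMs) hcode hfac

/-- The image of the coding between `z_i` and `z_{i+m}` is the coding between `-βz_{i+m}` and
`-βz_i`. -/
theorem gapAntimorphism_factor (h : IsParam β l) (hz : IsEnumeration β l z)
    (hv : IsCoding β l z v) (i : ℤ) (m : ℕ) :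
    ∃ (a : ℤ) (M : ℕ), z a = -β * z (i + m) ∧ z (a + M) = -β * z i ∧
      gapAntimorphism β l (factor v i m) = factor v a M := by
  induction m with
  | zero =>
    obtain ⟨a, ha⟩ : -β * z i ∈ Set.range z :=
      hz.2.2 ▸ neg_beta_mul_mem_integers h (hz.2.2 ▸ Set.mem_range_self i)
    exact ⟨a, 0, by simpa using ha, by simpa using ha, by simp [factor, gapAntimorphism]⟩
  | succ m ih =>
    obtain ⟨a, M, ha, hb, hf⟩ := ih
    obtain ⟨a', M', ha', hb', hf'⟩ := letterImage_eq_factor h hz hv (i + m)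
    have haa : a' + M' = a := hz.1.injective (hb'.trans ha.symm)
    refine ⟨a', M' + M, ?_, ?_, ?_⟩
    · rw [ha']; push_cast; congr 2; ring
    · rw [← hb, ← haa]; push_cast; congr 1; ring
    · rw [factor_add v i m 1, factor_one, gapAntimorphism_append, gapAntimorphism_singleton, hf,
        hf', factor_add, haa]

/-- The square of the antimorphism corresponds to multiplication by `β²`, which preserves the
order and fixes `0 = z_0`; hence the coding is a fixed point. -/
theorem isImage_gapAntimorphism_sq (h : IsParam β l) (hz : IsEnumeration β l z)
    (hv : IsCoding β l z v) :
    IsImage (gapAntimorphism β l ∘ gapAntimorphism β l) v v := by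
  have key : ∀ (i : ℤ) (m : ℕ), ∃ (a : ℤ) (M : ℕ), z a = -β * (-β * z i) ∧
      z (a + M) = -β * (-β * z (i + m)) ∧
      gapAntimorphism β l (gapAntimorphism β l (factor v i m)) = factor v a M := by
    intro i m
    obtain ⟨a, M, ha, hb, hf⟩ := gapAntimorphism_factor h hz hv i m
    obtain ⟨a', M', ha', hb', hf'⟩ := gapAntimorphism_factor h hz hv a M
    exact ⟨a', M', by rw [ha', hb], by rw [hb', ha], by rw [hf, hf']⟩
  have hz0 : ∀ a, z a = -β * (-β * z 0) → a = 0 := by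
    intro a ha
    refine hz.1.injective ?_
    rw [ha, hz.2.1]
    simp
  intro n
  constructor
  · obtain ⟨a, M, ha, -, hf⟩ := key 0 n
    rw [Function.comp_apply, hf, factor_length, hz0 a ha]
  · obtain ⟨a, M, -, hb, hf⟩ := key (-n) n
    rw [neg_add_cancel] at hb
    rw [Function.comp_apply, hf, factor_length, ← eq_neg_of_add_eq_zero_left (hz0 _ hb)]

end Main

end NegBeta

theorem mainTheorem2 :
    ∃ R S : ℕ → List ℤ → List ℤ → List ℤ → List ℤ → List ℕ,
      ∀ β l : ℝ, 1 < β → l ∈ Set.Icc (-β / (β + 1)) (-1 / (β + 1)) →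
        NegBeta.integers β l ≠ {0} →
        ∃ (z : ℤ → ℝ) (v : ℤ → ℕ),
          NegBeta.IsEnumeration β l z ∧
          (∀ z', NegBeta.IsEnumeration β l z' → z' = z) ∧
          NegBeta.IsCoding β l z v ∧
          (∀ v', NegBeta.IsCoding β l z v' → v' = v) ∧
          (∀ n, z (n + 1) - z n = NegBeta.gapLength β l (v n)) ∧
          ∃ Φ : List ℕ → List ℕ,
            NegBeta.IsAntimorphism Φ ∧
            NegBeta.IsMorphism (Φ ∘ Φ) ∧
            NegBeta.NonErasing (Φ ∘ Φ) ∧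
            Φ ∘ Φ ≠ id ∧
            NegBeta.IsImage (Φ ∘ Φ) v v ∧
            (∀ m : ℕ,
              Φ [2 * m] =
                S (2 * m) (NegBeta.minPrefix β l (2 * m)) (NegBeta.maxPrefix β l (2 * m))
                    (NegBeta.minPrefix β l (2 * m + 1)) (NegBeta.maxPrefix β l (2 * m + 1)) ++
                [2 * m + 1] ++
                (R (2 * m) (NegBeta.minPrefix β l (2 * m)) (NegBeta.maxPrefix β l (2 * m))
                    (NegBeta.minPrefix β l (2 * m + 1))
                    (NegBeta.maxPrefix β l (2 * m + 1))).reverse) ∧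
            (∀ m : ℕ,
              Φ [2 * m + 1] =
                R (2 * m + 1) (NegBeta.minPrefix β l (2 * m + 1))
                    (NegBeta.maxPrefix β l (2 * m + 1))
                    (NegBeta.minPrefix β l (2 * m + 2)) (NegBeta.maxPrefix β l (2 * m + 2)) ++
                [2 * m + 2] ++
                (S (2 * m + 1) (NegBeta.minPrefix β l (2 * m + 1))
                    (NegBeta.maxPrefix β l (2 * m + 1))
                    (NegBeta.minPrefix β l (2 * m + 2))
                    (NegBeta.maxPrefix β l (2 * m + 2))).reverse) := by
  refine ⟨NegBeta.wordR, NegBeta.wordS, fun β l hβ hl hne => ?_⟩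
  have h : NegBeta.IsParam β l := ⟨hβ, hl⟩
  obtain ⟨z, hz, hz0, hr⟩ := NegBeta.exists_enumeration (NegBeta.zero_mem_integers h)
    (NegBeta.finite_integers_inter_Icc h) (fun B => (NegBeta.exists_integers_gt_lt h hne B).1)
    (fun B => (NegBeta.exists_integers_gt_lt h hne B).2)
  have hmem : ∀ i, z i ∈ NegBeta.integers β l := fun i => hr ▸ Set.mem_range_self i
  choose v hv using fun n => NegBeta.exists_isGapOfType h (hmem n) (hmem (n + 1))
    (hz (lt_add_one n)) (fun t ht => NegBeta.no_mem_between hz hr n ht)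
  refine ⟨z, v, ⟨hz, hz0, hr⟩,
    fun z' hz' => NegBeta.enumeration_unique hz hz0 hr hz'.1 hz'.2.1 hz'.2.2, hv,
    fun v' hv' => ?_, fun n => NegBeta.sub_eq_gapLength h (hv n),
    NegBeta.gapAntimorphism β l, ⟨rfl, NegBeta.gapAntimorphism_append⟩, ⟨rfl, fun u w => ?_⟩,
    fun a ha => ?_, fun hid => ?_, NegBeta.isImage_gapAntimorphism_sq h ⟨hz, hz0, hr⟩ hv,
    fun m => ?_, fun m => ?_⟩
  · funext n
    obtain ⟨N, s, hs, t, ht, hsz, htz⟩ :=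
      NegBeta.exists_strongWords_pair h (hmem n) (hmem (n + 1))
    rw [← NegBeta.diffPos_eq_of_isGapOfType h (hv n) hs ht hsz htz,
      NegBeta.diffPos_eq_of_isGapOfType h (hv' n) hs ht hsz htz]
  · simp only [Function.comp_apply, NegBeta.gapAntimorphism_append]
  · have h2 := NegBeta.mem_gapAntimorphism (β := β) (l := l)
      (NegBeta.mem_gapAntimorphism (β := β) (l := l) (List.mem_singleton_self a))
    rw [Function.comp_apply] at ha
    simp [ha] at h2
  · -- the square of the antimorphism maps the letter `0` to a word containing the letter `2`
    have h2 := NegBeta.mem_gapAntimorphism (β := β) (l := l)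
      (NegBeta.mem_gapAntimorphism (β := β) (l := l) (List.mem_singleton_self 0))
    rw [← Function.comp_apply (f := NegBeta.gapAntimorphism β l), hid] at h2
    simp at h2
  · rw [NegBeta.gapAntimorphism_singleton, NegBeta.letterImage, if_pos (even_two_mul m)]
  · rw [NegBeta.gapAntimorphism_singleton, NegBeta.letterImage, if_neg (by simp)]
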